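/- Let $d\ge 0$, $n\ge 3$, $k\in\mathbb Z^d$, $\gamma>0$, and $\mathbb T^d=(\mathbb R/2\pi\mathbb Z)^d$ with Lebesgue measure of total mass $(2\pi)^d$. Let $\sigma_1:\mathbb T^d\to[0,\infty)$ be $C^\infty$ and even ($\sigma_1(-x)=\sigma_1(x)$, as is the case when $\sigma_1$ is radially symmetric) with $\int_{\mathbb T^d}\sigma_1\,dx\ne0$, and let $\sigma_2:\mathbb R^n\to[0,\infty)$ be $C^\infty$, radially symmetric and compactly supported, with $(-\Delta)^{-1/2}\sigma_2\in L^2(\mathbb R^n)$ and $\widehat\sigma_2(\xi)\neq0$ for all $\xi\in\mathbb R^n$. Put $$\sigma_{1,m}=\frac1{(2\pi)^d}\int_{\mathbb T^d}\sigma_1(x)e^{-im\cdot x}\,dx\quad(m\in\mathbb Z^d),\qquad \kappa=\int_{\mathbb R^n}\frac{|\widehat\sigma_2(\xi)|^2}{|\xi|^2}\frac{d\xi}{(2\pi)^n},\qquad \widehat\sigma_2(\xi)=\int_{\mathbb R^n}\sigma_2(z)e^{-i\xi\cdot z}\,dz,$$ and assume the smallness condition $4\gamma^2\kappa\|\sigma_1\|_{L^1(\mathbb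 T^d)}^2<1$. On the complex Hilbert space $\mathscr V=L^2(\mathbb T^d)\times L^2(\mathbb T^d)\times L^2(\mathbb T^d;L^2(\mathbb R^n))\times L^2(\mathbb T^d;L^2(\mathbb R^n))$ consider the unbounded operator $\mathscr L$ with domain $D(\mathscr L)=H^2(\mathbb T^d)\times H^2(\mathbb T^d)\times L^2(\mathbb T^d;L^2(\mathbb R^n))\times L^2(\mathbb T^d;L^2(\mathbb R^n))$ given by $$\mathscr L\begin{pmatrix}q\\p\\\phi\\\pi\end{pmatrix}=\begin{pmatrix}-\frac12\Delta_xq+k\cdot\nabla_xp+\gamma\,\sigma_1\star\int_{\mathbb R^n}\big((-\Delta)^{-1/2}\sigma_2\big)\phi\,dz\\[2pt]-\frac12\Delta_xp-k\cdot\nabla_xq\\[2pt]\frac12\phi+\gamma\,\big((-\Delta)^{-1/2}\sigma_2\big)\,\sigma_1\star q\\[2pt]\frac12\pi\end{pmatrix}.$$ Write $m^2=\sum_jm_j^2$ and $m^4=(m^2)^2$. The essential spectrum is the set of points of the spectrum that are not isolated eigenvalues of finite multiplicity. Then: 1. $\sigma_{\mathrm{ess}}(\mathscr L)=\{1/2\}$.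 2. $\mathscr L$ has finitely many negative eigenvalues, each with a finite-dimensional eigenspace, and their number $n(\mathscr L)$, counted with multiplicity, is $$n(\mathscr L)=1+\#\{m\in\mathbb Z^d\setminus\{0\}: m^4-4(k\cdot m)^2<0,\ \sigma_{1,m}=0\}+\#\{m\in\mathbb Z^d\setminus\{0\}: m^4-4(k\cdot m)^2\le0,\ \sigma_{1,m}\ne0\},$$ where both sets are finite. In particular $n(\mathscr L)=1$ when $k=0$. 3. With $X_0=(0,\mathbf 1,0,0)$, $\mathrm{span}_{\mathbb R}\{X_0\}\subset\mathrm{Ker}(\mathscr L)$. Moreover, with $\mathscr K_*=\{m\in\mathbb Z^d\setminus\{0\}: m^4-4(k\cdot m)^2=0,\ \sigma_{1,m}=0\}$, which is finite, $\mathrm{Ker}(\mathscr L)$ is finite-dimensional over $\mathbb C$ and $\dim\mathrm{Ker}(\mathscr L)=1+\#\mathscr K_*$. -/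

import Mathlib

open MeasureTheory
open scoped FourierTransform ContDiff

noncomputable section

namespace SchrodingerWave

instance factTwoPiPos : Fact (0 < 2 * Real.pi) := ⟨Real.two_pi_pos⟩

/-! ### Spectral notions for unbounded operators -/

section Spectral

variable {V : Type*} [NormedAddCommGroup V] [NormedSpace ℂ V]

/-- The eigenspace `Ker (A - μ)`, a subspace of the domain of `A`, seen inside `V`. -/
def eigenspace (A : V →ₗ.[ℂ] V) (μ : ℂ) : Submodule ℂ V :=
  (LinearMap.ker (A.toFun - μ • A.domain.subtype)).map A.domain.subtype

/-- The resolvent set: `A - μ` is a bijection from the domain of `A` onto `V` with a bounded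
inverse `R`. -/
def resolventSet (A : V →ₗ.[ℂ] V) : Set ℂ :=
  {μ | ∃ R : V →L[ℂ] V,
    (∀ y : V, ∃ h : R y ∈ A.domain, A ⟨R y, h⟩ - μ • R y = y) ∧
    ∀ x : A.domain, R (A x - μ • (x : V)) = x}

/-- The spectrum of an unbounded operator. -/
def unboundedSpectrum (A : V →ₗ.[ℂ] V) : Set ℂ := (resolventSet A)ᶜ

/-- The essential spectrum of a self-adjoint operator: the points of the spectrum which are not
isolated eigenvalues of finite multiplicity. -/
def essentialSpectrum (A : V →ₗ.[ℂ] V) : Set ℂ :=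
  {μ | μ ∈ unboundedSpectrum A ∧
    ¬ ((∃ ε > 0, ∀ ν ∈ unboundedSpectrum A, ‖ν - μ‖ < ε → ν = μ) ∧
        eigenspace A μ ≠ ⊥ ∧ FiniteDimensional ℂ (eigenspace A μ))}

/-- The negative eigenvalues of `A`. -/
def negativeEigenvalues (A : V →ₗ.[ℂ] V) : Set ℝ :=
  {μ | μ < 0 ∧ eigenspace A (μ : ℂ) ≠ ⊥}

/-- The number of negative eigenvalues of `A`, counted with multiplicity (meaningful when there are
finitely many of them and their eigenspaces are finite dimensional). -/
def negativeIndex (A : V →ₗ.[ℂ] V) : ℕ :=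
  ∑ᶠ μ ∈ negativeEigenvalues A, Module.finrank ℂ (eigenspace A (μ : ℂ))

end Spectral

/-! ### Function spaces -/

/-- The torus `(ℝ / 2πℤ)^d`; its `volume` is the Lebesgue measure, of total mass `(2π)^d`. -/
abbrev Torus (d : ℕ) : Type := Fin d → AddCircle (2 * Real.pi)

/-- `L²(𝕋^d; ℂ)`. -/
abbrev L2Torus (d : ℕ) : Type := Lp ℂ 2 (volume : Measure (Torus d))

/-- `L²(ℝ^n; ℂ)`. -/
abbrev L2Space (n : ℕ) : Type := Lp ℂ 2 (volume : Measure (EuclideanSpace ℝ (Fin n)))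

/-- `L²(𝕋^d; L²(ℝ^n; ℂ))`. -/
abbrev L2Field (d n : ℕ) : Type := Lp (L2Space n) 2 (volume : Measure (Torus d))

/-- The Hilbert space `L²(𝕋^d) × L²(𝕋^d) × L²(𝕋^d; L²(ℝ^n)) × L²(𝕋^d; L²(ℝ^n))`; its elements
`((q, p), (φ, π))` are the unknowns. -/
abbrev StateSpace (d n : ℕ) : Type :=
  WithLp 2 (WithLp 2 (L2Torus d × L2Torus d) × WithLp 2 (L2Field d n × L2Field d n))

/-! ### Fourier series on the torus -/

/-- The character `x ↦ exp (i m · x)`. -/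
def character {d : ℕ} (m : Fin d → ℤ) : C(Torus d, ℂ) where
  toFun x := ∏ j, fourier (m j) (x j)
  continuous_toFun := by fun_prop

/-- The character `x ↦ exp (i m · x)` as an element of `L²(𝕋^d)`. -/
def characterL2 {d : ℕ} (m : Fin d → ℤ) : L2Torus d :=
  ContinuousMap.toLp 2 volume ℂ (character m)

/-- The Fourier coefficient `f_m = (2π)^{-d} ∫ f(x) exp (-i m · x) dx`. -/
def coeff {d : ℕ} (f : Torus d → ℂ) (m : Fin d → ℤ) : ℂ :=
  ((2 * Real.pi : ℂ) ^ d)⁻¹ * ∫ x, f x * character (-m) x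

theorem integrable_mul_character {d : ℕ} (q : L2Torus d) (m : Fin d → ℤ) :
    Integrable (fun x => q x * character m x) volume := by
  have h2 : MemLp (fun x : Torus d => character m x) 2 volume :=
    (character m).continuous.memLp_of_hasCompactSupport (HasCompactSupport.of_compactSpace _)
  exact (Lp.memLp q).integrable_mul h2

theorem coeff_add {d : ℕ} (q r : L2Torus d) (m : Fin d → ℤ) :
    coeff (q + r : L2Torus d) m = coeff q m + coeff r m := by
  unfold coeff
  rw [← mul_add, ← integral_add (integrable_mul_character q _) (integrable_mul_character r _)]
  congr 1
  apply integral_congr_ae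
  filter_upwards [Lp.coeFn_add q r] with x hx
  rw [hx, Pi.add_apply, add_mul]

theorem coeff_smul {d : ℕ} (a : ℂ) (q : L2Torus d) (m : Fin d → ℤ) :
    coeff (a • q : L2Torus d) m = a * coeff q m := by
  have h : ∫ x, (a • q : L2Torus d) x * character (-m) x = a * ∫ x, q x * character (-m) x := by
    rw [← integral_const_mul]
    apply integral_congr_ae
    filter_upwards [Lp.coeFn_smul a q] with x hx
    rw [hx, Pi.smul_apply, smul_eq_mul, mul_assoc]
  unfold coeff
  rw [h, mul_left_comm]

theorem character_inner_fourier (a b : ℤ) :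
    ∫ x : AddCircle (2 * Real.pi), fourier (-a) x * fourier b x
      = if a = b then ((2 * Real.pi : ℝ) : ℂ) else 0 := by
  have h := (orthonormal_iff_ite.mp (orthonormal_fourier (T := 2 * Real.pi))) a b
  rw [ContinuousMap.inner_toLp] at h
  rw [AddCircle.volume_eq_smul_haarAddCircle, integral_smul_measure,
    ENNReal.toReal_ofReal Real.two_pi_pos.le]
  have h2 : ∫ x : AddCircle (2 * Real.pi), fourier (-a) x * fourier b x ∂AddCircle.haarAddCircle
      = if a = b then 1 else 0 := by
    rw [← h]
    congr 1
    ext x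
    rw [fourier_neg, mul_comm]
  rw [h2]
  split_ifs <;> simp

/-- The characters are pairwise orthogonal in `L²(𝕋^d)`, with squared norm `(2π)^d`. -/
theorem inner_characterL2 {d : ℕ} (m l : Fin d → ℤ) :
    inner ℂ (characterL2 m) (characterL2 l)
      = if m = l then ((2 * Real.pi : ℝ) : ℂ) ^ d else 0 := by
  unfold characterL2
  rw [ContinuousMap.inner_toLp]
  have h1 : ∀ x : Torus d, character l x * (starRingEnd ℂ) (character m x)
      = ∏ j, (fourier (-m j) (x j) * fourier (l j) (x j)) := by
    intro x
    simp only [character, ContinuousMap.coe_mk, map_prod, fourier_neg, Finset.prod_mul_distrib]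
    rw [mul_comm]
  simp_rw [h1]
  rw [integral_fintype_prod_volume_eq_prod
    (f := fun j (y : AddCircle (2 * Real.pi)) => fourier (-m j) y * fourier (l j) y)]
  simp_rw [character_inner_fourier]
  split_ifs with h
  · subst h
    simp
  · obtain ⟨i, hi⟩ := Function.ne_iff.mp h
    exact Finset.prod_eq_zero (Finset.mem_univ i) (by simp [hi])

/-- A series of multiples of the characters with square summable coefficients converges. -/
theorem summable_smul_characterL2 {d : ℕ} {c : (Fin d → ℤ) → ℂ}
    (hc : Summable fun m => ‖c m‖ ^ 2) : Summable fun m => c m • characterL2 m := by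
  have hs : (0 : ℝ) < Real.sqrt ((2 * Real.pi) ^ d) := Real.sqrt_pos.mpr (by positivity)
  set s : ℂ := (Real.sqrt ((2 * Real.pi) ^ d) : ℂ) with hsdef
  have hs0 : s ≠ 0 := by rw [hsdef]; exact_mod_cast hs.ne'
  have hss : s * s = ((2 * Real.pi : ℝ) : ℂ) ^ d := by
    rw [hsdef, ← Complex.ofReal_mul, Real.mul_self_sqrt (by positivity)]
    push_cast
    rfl
  have hstar : (starRingEnd ℂ) s = s := Complex.conj_ofReal _
  have ho : Orthonormal ℂ fun m : Fin d → ℤ => s⁻¹ • characterL2 m := by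
    rw [orthonormal_iff_ite]
    intro m l
    rw [inner_smul_left, inner_smul_right, inner_characterL2, map_inv₀, hstar]
    split_ifs
    · rw [← hss]
      field_simp
    · simp
  have h := (ho.orthogonalFamily.summable_iff_norm_sq_summable fun m => s * c m).mpr (by
    simp only [norm_mul, mul_pow]
    exact hc.mul_left _)
  refine h.congr fun m => ?_
  simp only [LinearIsometry.toSpanSingleton_apply, smul_smul]
  congr 1
  field_simp

/-- The Sobolev space `H²(𝕋^d)`: the `q ∈ L²(𝕋^d)` with `∑ (1 + m²)² |q_m|² < ∞`. -/
def sobolevTwo (d : ℕ) : Submodule ℂ (L2Torus d) where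
  carrier := {q | Summable fun m : Fin d → ℤ => (1 + ((m ⬝ᵥ m : ℤ) : ℝ)) ^ 2 * ‖coeff q m‖ ^ 2}
  add_mem' := by
    intro q r hq hr
    refine Summable.of_nonneg_of_le (fun m => by positivity) (fun m => ?_)
      ((hq.mul_left 2).add (hr.mul_left 2))
    rw [coeff_add]
    have h1 : ‖coeff q m + coeff r m‖ ^ 2 ≤ 2 * ‖coeff q m‖ ^ 2 + 2 * ‖coeff r m‖ ^ 2 := by
      have h2 := norm_add_le (coeff q m) (coeff r m)
      nlinarith [sq_nonneg (‖coeff q m‖ - ‖coeff r m‖), norm_nonneg (coeff q m + coeff r m)]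
    calc _ ≤ (1 + ((m ⬝ᵥ m : ℤ) : ℝ)) ^ 2 * (2 * ‖coeff q m‖ ^ 2 + 2 * ‖coeff r m‖ ^ 2) := by
          gcongr
      _ = _ := by ring
  zero_mem' := by
    have h : ∀ m : Fin d → ℤ, coeff (0 : L2Torus d) m = 0 := fun m => by
      simpa using coeff_smul 0 (0 : L2Torus d) m
    refine (summable_zero (α := ℝ)).congr fun m => ?_
    change _ = (1 + ((m ⬝ᵥ m : ℤ) : ℝ)) ^ 2 * ‖coeff (0 : L2Torus d) m‖ ^ 2
    rw [h, norm_zero]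
    ring
  smul_mem' := by
    intro a q hq
    refine (hq.mul_left (‖a‖ ^ 2)).congr fun m => ?_
    rw [coeff_smul, norm_mul]
    ring

theorem dotProduct_self_nonneg_real {d : ℕ} (m : Fin d → ℤ) : (0 : ℝ) ≤ ((m ⬝ᵥ m : ℤ) : ℝ) := by
  exact_mod_cast Finset.sum_nonneg fun j _ => mul_self_nonneg (m j)

/-- Differential operators of order at most two with constant coefficients on `H²(𝕋^d)`: if the
symbol `a` satisfies `|a m| ≤ C (1 + m²)`, this is the operator
`∑ q_m exp (i m · x) ↦ ∑ a(m) q_m exp (i m · x)`, with convergence in `L²(𝕋^d)`. -/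
def fourierMultiplier {d : ℕ} (a : (Fin d → ℤ) → ℂ)
    (ha : ∃ C : ℝ, ∀ m, ‖a m‖ ≤ C * (1 + ((m ⬝ᵥ m : ℤ) : ℝ))) :
    sobolevTwo d →ₗ[ℂ] L2Torus d :=
  have hsum : ∀ q : sobolevTwo d,
      Summable fun m => (a m * coeff (q : L2Torus d) m) • characterL2 m := by
    intro q
    obtain ⟨C, hC⟩ := ha
    refine summable_smul_characterL2 (Summable.of_nonneg_of_le (fun m => sq_nonneg _)
      (fun m => ?_) (q.2.mul_left (C ^ 2)))
    rw [norm_mul, mul_pow, ← mul_assoc, ← mul_pow C]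
    exact mul_le_mul_of_nonneg_right (pow_le_pow_left₀ (norm_nonneg _) (hC m) 2) (sq_nonneg _)
  { toFun := fun q => ∑' m, (a m * coeff (q : L2Torus d) m) • characterL2 m
    map_add' := fun q r => by
      rw [← (hsum q).tsum_add (hsum r)]
      congr 1
      ext1 m
      rw [Submodule.coe_add, coeff_add, mul_add, add_smul]
    map_smul' := fun t q => by
      rw [RingHom.id_apply, ← (hsum q).tsum_const_smul]
      congr 1
      ext1 m
      rw [Submodule.coe_smul, coeff_smul, smul_smul]
      congr 1
      ring }

/-- The Laplacian `Δ` on `H²(𝕋^d)`, of symbol `-m²`. -/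
def laplacian (d : ℕ) : sobolevTwo d →ₗ[ℂ] L2Torus d :=
  fourierMultiplier (fun m => -((m ⬝ᵥ m : ℤ) : ℂ)) ⟨1, fun m => by
    have h := dotProduct_self_nonneg_real m
    rw [norm_neg, Complex.norm_intCast, abs_of_nonneg h]
    linarith⟩

/-- The transport operator `k · ∇` on `H²(𝕋^d)`, of symbol `i k · m`. -/
def dotGradient {d : ℕ} (k : Fin d → ℤ) : sobolevTwo d →ₗ[ℂ] L2Torus d :=
  fourierMultiplier (fun m => Complex.I * ((k ⬝ᵥ m : ℤ) : ℂ)) ⟨((k ⬝ᵥ k : ℤ) : ℝ) + 1, fun m => by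
    have hk := dotProduct_self_nonneg_real k
    have hm := dotProduct_self_nonneg_real m
    rw [norm_mul, Complex.norm_I, one_mul, Complex.norm_intCast]
    have h1 : (0 : ℝ) ≤ (((k - m) ⬝ᵥ (k - m) : ℤ) : ℝ) := dotProduct_self_nonneg_real _
    have h2 : (0 : ℝ) ≤ (((k + m) ⬝ᵥ (k + m) : ℤ) : ℝ) := dotProduct_self_nonneg_real _
    simp only [sub_dotProduct, dotProduct_sub, add_dotProduct, dotProduct_add,
      dotProduct_comm m k] at h1 h2
    push_cast at h1 h2
    rw [abs_le]
    constructor <;> nlinarith [mul_nonneg hk hm]⟩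

/-! ### The coupling terms -/

theorem integrable_convolution {d : ℕ} (σ : C(Torus d, ℝ)) (q : L2Torus d) (x : Torus d) :
    Integrable (fun y => (σ (x - y) : ℂ) * q y) volume := by
  have h : Continuous fun y : Torus d => (σ (x - y) : ℂ) := by fun_prop
  have h2 : MemLp (fun y : Torus d => (σ (x - y) : ℂ)) 2 volume :=
    h.memLp_of_hasCompactSupport (HasCompactSupport.of_compactSpace _)
  exact h2.integrable_mul (Lp.memLp q)

theorem continuous_convolution {d : ℕ} (σ : C(Torus d, ℝ)) (q : L2Torus d) :
    Continuous fun x : Torus d => ∫ y, (σ (x - y) : ℂ) * q y := by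
  have hq : Integrable (fun y => q y) volume := (Lp.memLp q).integrable one_le_two
  refine continuous_of_dominated (bound := fun y => ‖σ‖ * ‖q y‖)
    (fun x => (integrable_convolution σ q x).aestronglyMeasurable) (fun x => ?_)
    (hq.norm.const_mul _) (Filter.Eventually.of_forall fun y => by fun_prop)
  refine Filter.Eventually.of_forall fun y => ?_
  rw [norm_mul, Complex.norm_real]
  exact mul_le_mul_of_nonneg_right (σ.norm_coe_le_norm _) (norm_nonneg _)

/-- The convolution `σ ⋆ q : x ↦ ∫ σ(x - y) q(y) dy` on `L²(𝕋^d)`. -/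
def convolution {d : ℕ} (σ : C(Torus d, ℝ)) : L2Torus d →ₗ[ℂ] L2Torus d where
  toFun q := ((continuous_convolution σ q).memLp_of_hasCompactSupport
    (HasCompactSupport.of_compactSpace _) : MemLp _ 2 volume).toLp
      (fun x : Torus d => ∫ y, (σ (x - y) : ℂ) * q y)
  map_add' q r := by
    rw [← MemLp.toLp_add]
    congr 1
    ext1 x
    rw [Pi.add_apply, ← integral_add (integrable_convolution σ q x) (integrable_convolution σ r x)]
    apply integral_congr_ae
    filter_upwards [Lp.coeFn_add q r] with y hy
    rw [hy, Pi.add_apply, mul_add]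
  map_smul' a q := by
    rw [RingHom.id_apply, ← MemLp.toLp_const_smul]
    congr 1
    ext1 x
    rw [Pi.smul_apply, smul_eq_mul, ← integral_const_mul]
    apply integral_congr_ae
    filter_upwards [Lp.coeFn_smul a q] with y hy
    rw [hy, Pi.smul_apply, smul_eq_mul, mul_left_comm]

theorem integral_mul_eq_inner {n : ℕ} (S φ : L2Space n) :
    ∫ z, S z * φ z = inner ℂ (star S) φ := by
  rw [L2.inner_def]
  apply integral_congr_ae
  filter_upwards [Lp.coeFn_star S] with z hz
  rw [hz, RCLike.inner_apply, Pi.star_apply, starRingEnd_apply, star_star, mul_comm]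

theorem norm_star_L2 {n : ℕ} (S : L2Space n) : ‖star S‖ = ‖S‖ := by
  rw [Lp.norm_def, Lp.norm_def]
  congr 1
  apply eLpNorm_congr_norm_ae
  filter_upwards [Lp.coeFn_star S] with z hz
  rw [hz, Pi.star_apply, norm_star]

/-- The linear form `φ ↦ ∫ S(z) φ(z) dz` on `L²(ℝ^n)`. -/
def pairing {n : ℕ} (S : L2Space n) : L2Space n →L[ℂ] ℂ :=
  LinearMap.mkContinuous
    { toFun := fun φ => ∫ z, S z * φ z
      map_add' := fun φ ψ => by
        simp only [integral_mul_eq_inner, inner_add_right]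
      map_smul' := fun a φ => by
        simp only [integral_mul_eq_inner, inner_smul_right, RingHom.id_apply, smul_eq_mul] }
    ‖S‖ fun φ => by
      change ‖∫ z, S z * φ z‖ ≤ _
      rw [integral_mul_eq_inner]
      exact (norm_inner_le_norm _ _).trans_eq (by rw [norm_star_L2])

/-- The map `φ ↦ (x ↦ ∫ S(z) φ(x, z) dz)` from `L²(𝕋^d; L²(ℝ^n))` to `L²(𝕋^d)`. -/
def fieldAverage {d n : ℕ} (S : L2Space n) : L2Field d n →L[ℂ] L2Torus d :=
  (pairing S).compLpL 2 volume

/-- The map `f ↦ ((x, z) ↦ f(x) S(z))` from `L²(𝕋^d)` to `L²(𝕋^d; L²(ℝ^n))`. -/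
def tensorField {d n : ℕ} (S : L2Space n) : L2Torus d →L[ℂ] L2Field d n :=
  (ContinuousLinearMap.toSpanSingleton ℂ S).compLpL 2 volume

/-- The Fourier transform of `(-Δ)^{-1/2} σ₂`. With the normalization
`𝓕 f(ξ) = ∫ f(z) exp (-2πi ξ · z) dz`, the operator `-Δ` has symbol `(2π|ξ|)²`. -/
def rieszSymbol {n : ℕ} (σ₂ : EuclideanSpace ℝ (Fin n) → ℝ) (ξ : EuclideanSpace ℝ (Fin n)) : ℂ :=
  𝓕 (fun z => (σ₂ z : ℂ)) ξ / ((2 * Real.pi * ‖ξ‖ : ℝ) : ℂ)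

/-- `(-Δ)^{-1/2} σ₂` as an element of `L²(ℝ^n)`. -/
def invSqrtLaplacian {n : ℕ} (σ₂ : EuclideanSpace ℝ (Fin n) → ℝ)
    (h : MemLp (rieszSymbol σ₂) 2 volume) : L2Space n :=
  𝓕⁻ (h.toLp (rieszSymbol σ₂))

/-- The constant `κ = ∫ σ₂ (-Δ)^{-1} σ₂ dz`, through Plancherel's formula. -/
def kappa {n : ℕ} (σ₂ : EuclideanSpace ℝ (Fin n) → ℝ) : ℝ :=
  ∫ ξ, ‖rieszSymbol σ₂ ξ‖ ^ 2

/-! ### The operator -/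

/-- The domain `H²(𝕋^d) × H²(𝕋^d) × L²(𝕋^d; L²(ℝ^n)) × L²(𝕋^d; L²(ℝ^n))`. -/
def domainL (d n : ℕ) : Submodule ℂ (StateSpace d n) where
  carrier := {X | X.fst.fst ∈ sobolevTwo d ∧ X.fst.snd ∈ sobolevTwo d}
  add_mem' hX hY := ⟨add_mem hX.1 hY.1, add_mem hX.2 hY.2⟩
  zero_mem' := ⟨zero_mem _, zero_mem _⟩
  smul_mem' a _ hX := ⟨Submodule.smul_mem _ a hX.1, Submodule.smul_mem _ a hX.2⟩

/-- The component `q` of an element of the domain. -/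
def compQ (d n : ℕ) : domainL d n →ₗ[ℂ] sobolevTwo d where
  toFun X := ⟨(X : StateSpace d n).fst.fst, X.2.1⟩
  map_add' _ _ := rfl
  map_smul' _ _ := rfl

/-- The component `p` of an element of the domain. -/
def compP (d n : ℕ) : domainL d n →ₗ[ℂ] sobolevTwo d where
  toFun X := ⟨(X : StateSpace d n).fst.snd, X.2.2⟩
  map_add' _ _ := rfl
  map_smul' _ _ := rfl

/-- The component `φ` of an element of the domain. -/
def compPhi (d n : ℕ) : domainL d n →ₗ[ℂ] L2Field d n where
  toFun X := (X : StateSpace d n).snd.fst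
  map_add' _ _ := rfl
  map_smul' _ _ := rfl

/-- The component `π` of an element of the domain. -/
def compPi (d n : ℕ) : domainL d n →ₗ[ℂ] L2Field d n where
  toFun X := (X : StateSpace d n).snd.snd
  map_add' _ _ := rfl
  map_smul' _ _ := rfl

/-- The unbounded operator
`(q, p, φ, π) ↦ (-½ Δq + k·∇p + γ σ₁ ⋆ ∫ S φ dz, -½ Δp - k·∇q, ½ φ + γ S (σ₁ ⋆ q), ½ π)`;
the operator of the theorem is obtained for `S = (-Δ)^{-1/2} σ₂`. -/
def operatorL {d n : ℕ} (k : Fin d → ℤ) (γ : ℝ) (σ₁ : C(Torus d, ℝ)) (S : L2Space n) :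
    StateSpace d n →ₗ.[ℂ] StateSpace d n where
  domain := domainL d n
  toFun :=
    { toFun := fun X =>
        let q := compQ d n X
        let p := compP d n X
        let φ := compPhi d n X
        let π := compPi d n X
        WithLp.toLp 2
          (WithLp.toLp 2
            (-((1 / 2 : ℂ) • laplacian d q) + dotGradient k p
                + (γ : ℂ) • convolution σ₁ (fieldAverage S φ),
              -((1 / 2 : ℂ) • laplacian d p) - dotGradient k q),
            WithLp.toLp 2
              ((1 / 2 : ℂ) • φ + (γ : ℂ) • tensorField S (convolution σ₁ (q : L2Torus d)),
                (1 / 2 : ℂ) • π))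
      map_add' := fun X Y => by
        simp only [Submodule.coe_add, map_add, smul_add, ← WithLp.toLp_add, Prod.mk_add_mk]
        congr 4 <;> abel
      map_smul' := fun a X => by
        simp only [Submodule.coe_smul, map_smul, smul_add, smul_neg, smul_sub, smul_comm a,
          RingHom.id_apply, ← WithLp.toLp_smul, Prod.smul_mk] }

/-- The vector `X₀ = (0, 𝟏, 0, 0)`. -/
def vectorXZero (d n : ℕ) : StateSpace d n :=
  WithLp.toLp 2 (WithLp.toLp 2 (0, characterL2 0), 0)

end SchrodingerWave

end

/-!
In Fourier series on the torus `𝓛` splits over the modes `m`. For `μ ≠ 1/2` the equations on the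
fields `φ` and `π` can be solved, and `𝓛 - μ` reduces on each mode to the `2 × 2` matrix
`(a/2 - μ - t/(1/2 - μ), i b; -i b, a/2 - μ)`, where `a = m²`, `b = k · m` and
`t = (γ (2π)^d σ_{1,m})² κ`. Divided by `1 + a` it tends to half the identity as `m` goes to
infinity, so that it is singular on finitely many modes only: away from `1/2` the spectrum consists
of isolated eigenvalues of finite multiplicity. The point `1/2` is in the essential spectrum, since
every `(0, 0, 0, π)` with `π ≠ 0` is an eigenvector for it.

For `μ < 0` the Schur complement `a/2 - μ - t/(1/2 - μ) - b²/(a/2 - μ)` is strictly decreasing in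
`μ` and positive at `-∞`, so that a mode carries one negative eigenvalue if its limit at `0` is
negative and none otherwise. For `m ≠ 0` this limit is `(a² - 4b² - 4ta) / (2a)`. The smallness
condition gives `4ta < a`, and the integer `a² - 4b² = (a - 2|b|)(a + 2|b|)` is at least `a` when it
is positive; hence the coupling never changes the sign of a nonzero `a² - 4b²`, and it makes the
limit negative when `a² - 4b² = 0` and `t > 0`. The mode `0`, on which `t > 0`, carries the kernel
vector `p = 1` besides one negative eigenvalue.
-/

noncomputable section

namespace SchrodingerWave

open Filter Topology ComplexConjugate

/-! ### Fourier coefficients on the torus -/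

section Torus

variable {d : ℕ}

theorem character_zero : character (0 : Fin d → ℤ) = 1 := by
  ext x
  simp [character]

theorem character_neg (m : Fin d → ℤ) (x : Torus d) : character (-m) x = conj (character m x) := by
  simp only [character, Pi.neg_apply, fourier_neg, ContinuousMap.coe_mk, map_prod]

theorem character_apply_add (m : Fin d → ℤ) (x y : Torus d) :
    character m (x + y) = character m x * character m y := by
  simp [character, ← Finset.prod_mul_distrib, AddCircle.toCircle_add, smul_add]

theorem character_apply_neg (m : Fin d → ℤ) (x : Torus d) :
    character m (-x) = character (-m) x := by
  simp only [character, ContinuousMap.coe_mk, Pi.neg_apply, fourier_apply, smul_neg, neg_smul]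

theorem norm_character_apply (m : Fin d → ℤ) (x : Torus d) : ‖character m x‖ = 1 := by
  simp only [character, ContinuousMap.coe_mk, norm_prod, fourier_apply, Circle.norm_coe,
    Finset.prod_const_one]

/-- The rescaling `(ℝ / 2πℤ)^d ≃ (ℝ / ℤ)^d`, through which Mathlib's Fourier analysis on the unit
torus is transferred to `Torus d`. -/
def toUnitAddTorus (d : ℕ) : Torus d ≃ₜ UnitAddTorus (Fin d) :=
  Homeomorph.piCongrRight fun _ =>
    AddCircle.homeomorphAddCircle _ _ Real.two_pi_pos.ne' one_ne_zero

theorem mFourier_toUnitAddTorus (m : Fin d → ℤ) (x : Torus d) :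
    UnitAddTorus.mFourier m (toUnitAddTorus d x) = character m x := by
  change ∏ j, fourier (m j) (AddCircle.homeomorphAddCircle _ _ _ _ (x j))
    = ∏ j, fourier (m j) (x j)
  refine Finset.prod_congr rfl fun j _ => ?_
  obtain ⟨y, hy⟩ := QuotientAddGroup.mk_surjective (x j)
  rw [← hy, AddCircle.homeomorphAddCircle_apply_mk, fourier_coe_apply, fourier_coe_apply]
  push_cast
  congr 1
  field_simp

theorem span_character_closure_eq_top :
    (Submodule.span ℂ (Set.range (character (d := d)))).topologicalClosure = ⊤ := by
  let pullback : C(UnitAddTorus (Fin d), ℂ) →L[ℂ] C(Torus d, ℂ) :=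
    ContinuousMap.compCLM ℂ ℂ (toUnitAddTorus d : C(Torus d, UnitAddTorus (Fin d)))
  have pullback_surjective : Function.Surjective pullback := fun f =>
    ⟨f.comp (toUnitAddTorus d).symm, ContinuousMap.ext fun x => by simp [pullback]⟩
  have character_eq : (character : (Fin d → ℤ) → _) = pullback ∘ UnitAddTorus.mFourier :=
    funext fun m => ContinuousMap.ext fun x => (mFourier_toUnitAddTorus m x).symm
  have h := pullback_surjective.denseRange.topologicalClosure_map_submodule
    UnitAddTorus.span_mFourier_closure_eq_top
  rw [Submodule.map_span, ← Set.range_comp] at h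
  rw [character_eq]
  exact h

theorem dense_span_characterL2 :
    Dense (Submodule.span ℂ (Set.range (characterL2 (d := d))) : Set (L2Torus d)) := by
  have h := (ContinuousMap.toLp_denseRange ℂ (volume : Measure (Torus d)) ℂ
    (p := 2) (by simp)).topologicalClosure_map_submodule span_character_closure_eq_top
  rw [Submodule.map_span, ← Set.range_comp] at h
  exact Submodule.dense_iff_topologicalClosure_eq_top.mpr h

theorem two_pi_pow_ne_zero (d : ℕ) : (2 * Real.pi : ℂ) ^ d ≠ 0 :=
  pow_ne_zero _ (by simp [Real.pi_ne_zero])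

theorem integral_mul_character_neg (f : Torus d → ℂ) (m : Fin d → ℤ) :
    ∫ x, f x * character (-m) x = (2 * Real.pi : ℂ) ^ d * coeff f m := by
  rw [coeff, mul_inv_cancel_left₀ (two_pi_pow_ne_zero d)]

theorem inner_characterL2_eq_coeff (m : Fin d → ℤ) (q : L2Torus d) :
    inner ℂ (characterL2 m) q = (2 * Real.pi : ℂ) ^ d * coeff q m := by
  rw [← integral_mul_character_neg, L2.inner_def]
  apply integral_congr_ae
  filter_upwards [ContinuousMap.coeFn_toLp (p := 2) (𝕜 := ℂ) volume (character m)] with x hx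
  rw [characterL2, hx, character_neg, RCLike.inner_apply]

theorem coeff_eq_inner (q : L2Torus d) (m : Fin d → ℤ) :
    coeff q m = ((2 * Real.pi : ℂ) ^ d)⁻¹ * inner ℂ (characterL2 m) q := by
  rw [inner_characterL2_eq_coeff, inv_mul_cancel_left₀ (two_pi_pow_ne_zero d)]

theorem L2Torus_ext_coeff {q r : L2Torus d} (h : ∀ m, coeff q m = coeff r m) : q = r := by
  refine (innerSL_inj (𝕜 := ℂ)).mp (ContinuousLinearMap.ext_on dense_span_characterL2 ?_)
  rintro _ ⟨m, rfl⟩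
  rw [innerSL_apply_apply, innerSL_apply_apply, ← inner_conj_symm, inner_characterL2_eq_coeff, h,
    ← inner_characterL2_eq_coeff, inner_conj_symm]

/-- The Fourier coefficient as a continuous linear form on `L²(𝕋^d)`. -/
def coeffCLM (m : Fin d → ℤ) : L2Torus d →L[ℂ] ℂ :=
  ((2 * Real.pi : ℂ) ^ d)⁻¹ • innerSL ℂ (characterL2 m)

theorem coeffCLM_apply (m : Fin d → ℤ) (q : L2Torus d) : coeffCLM m q = coeff q m :=
  (coeff_eq_inner q m).symm

theorem coeff_zero (m : Fin d → ℤ) : coeff (0 : L2Torus d) m = 0 := by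
  simp only [← coeffCLM_apply, map_zero]

theorem coeff_neg (q : L2Torus d) (m : Fin d → ℤ) : coeff (-q : L2Torus d) m = -coeff q m := by
  simp only [← coeffCLM_apply, map_neg]

theorem coeff_sub (q r : L2Torus d) (m : Fin d → ℤ) :
    coeff (q - r : L2Torus d) m = coeff q m - coeff r m := by
  simp only [← coeffCLM_apply, map_sub]

theorem coeff_characterL2 (l m : Fin d → ℤ) :
    coeff (characterL2 l) m = if m = l then 1 else 0 := by
  rw [coeff_eq_inner, inner_characterL2]
  split_ifs
  · push_cast
    exact inv_mul_cancel₀ (two_pi_pow_ne_zero d)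
  · exact mul_zero _

theorem coeff_tsum_smul_characterL2 {c : (Fin d → ℤ) → ℂ}
    (hc : Summable fun m => c m • characterL2 m) (m : Fin d → ℤ) :
    coeff (∑' l, c l • characterL2 l : L2Torus d) m = c m := by
  rw [← coeffCLM_apply, (coeffCLM m).map_tsum hc, tsum_eq_single m]
  · simp [coeffCLM_apply, coeff_characterL2]
  · intro l hl
    simp [coeffCLM_apply, coeff_characterL2, hl.symm]

theorem summable_norm_coeff_sq (q : L2Torus d) : Summable fun m => ‖coeff q m‖ ^ 2 := by
  set s : ℂ := ((2 * Real.pi : ℝ) : ℂ) ^ d with hs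
  have hs0 : s ≠ 0 := by simp [hs, Real.pi_ne_zero]
  set r : ℝ := √((2 * Real.pi) ^ d) with hr
  have hrs : (r : ℂ) * r = s := by
    rw [hs, ← Complex.ofReal_pow, ← Complex.ofReal_mul, hr, Real.mul_self_sqrt (by positivity)]
  have orthonormal_character : Orthonormal ℂ fun m : Fin d → ℤ => (r : ℂ)⁻¹ • characterL2 m := by
    rw [orthonormal_iff_ite]
    intro m l
    rw [inner_smul_left, inner_smul_right, inner_characterL2, map_inv₀, Complex.conj_ofReal,
      ← mul_assoc, ← mul_inv, hrs, mul_ite, inv_mul_cancel₀ hs0, mul_zero]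
  refine ((orthonormal_character.inner_products_summable q).mul_left (‖(r : ℂ)⁻¹‖ ^ 2)).congr
    fun m => ?_
  rw [← mul_pow, ← norm_mul, inner_smul_left, map_inv₀, Complex.conj_ofReal, ← mul_assoc,
    ← mul_inv, hrs, coeff_eq_inner, hs, Complex.ofReal_mul, Complex.ofReal_ofNat]

end Torus

/-! ### Fourier multipliers -/

section Multiplier

theorem tendsto_dotProduct_self_cofinite {ι : Type*} [Fintype ι] :
    Tendsto (fun m : ι → ℤ => ((m ⬝ᵥ m : ℤ) : ℝ)) cofinite atTop := by
  have norm_le_dotProduct_self : ∀ m : ι → ℤ, ‖m‖ ≤ ((m ⬝ᵥ m : ℤ) : ℝ) := fun m => by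
    have hm : ∀ i, (m i : ℝ) ^ 2 ≤ ((m ⬝ᵥ m : ℤ) : ℝ) := fun i => by
      rw [dotProduct, ← Int.cast_pow, Int.cast_le, sq]
      exact Finset.single_le_sum (N := ℤ) (s := Finset.univ) (f := fun i => m i * m i)
        (fun i _ => mul_self_nonneg (m i)) (Finset.mem_univ i)
    refine (pi_norm_le_iff_of_nonneg ?_).mpr fun i => le_trans ?_ (hm i)
    · exact_mod_cast Finset.sum_nonneg fun i _ => mul_self_nonneg (m i)
    · rw [Int.norm_eq_abs, ← sq_abs]
      exact_mod_cast Int.le_self_sq |m i|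
  rw [← cocompact_eq_cofinite]
  exact tendsto_atTop_mono norm_le_dotProduct_self tendsto_norm_cocompact_atTop

theorem summable_norm_sq_of_norm_le_mul {ι E F : Type*} [SeminormedAddCommGroup E]
    [SeminormedAddCommGroup F] {f : ι → E} {g : ι → F} {C : ℝ}
    (hg : Summable fun i => ‖g i‖ ^ 2) (h : ∀ i, ‖f i‖ ≤ C * ‖g i‖) :
    Summable fun i => ‖f i‖ ^ 2 :=
  .of_nonneg_of_le (fun _ => sq_nonneg _)
    (fun i => (pow_le_pow_left₀ (norm_nonneg _) (h i) 2).trans_eq (mul_pow ..))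
    (hg.mul_left (C ^ 2))

variable {d : ℕ}

theorem mem_sobolevTwo_iff {q : L2Torus d} : q ∈ sobolevTwo d ↔
    Summable fun m : Fin d → ℤ => ‖(1 + ((m ⬝ᵥ m : ℤ) : ℝ)) * coeff q m‖ ^ 2 := by
  refine summable_congr fun m => ?_
  rw [norm_mul, mul_pow, ← Complex.ofReal_one, ← Complex.ofReal_add, Complex.norm_real,
    Real.norm_eq_abs, sq_abs]

theorem coeff_fourierMultiplier {a : (Fin d → ℤ) → ℂ}
    (ha : ∃ C : ℝ, ∀ m, ‖a m‖ ≤ C * (1 + ((m ⬝ᵥ m : ℤ) : ℝ))) (q : sobolevTwo d)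
    (m : Fin d → ℤ) :
    coeff (fourierMultiplier a ha q) m = a m * coeff (q : L2Torus d) m := by
  obtain ⟨C, hC⟩ := ha
  refine coeff_tsum_smul_characterL2 (c := fun m => a m * coeff (q : L2Torus d) m)
    (summable_smul_characterL2 (summable_norm_sq_of_norm_le_mul (C := C)
      (mem_sobolevTwo_iff.mp q.2) fun m => ?_)) m
  have hm := dotProduct_self_nonneg_real m
  rw [norm_mul, norm_mul, ← mul_assoc, ← Complex.ofReal_one, ← Complex.ofReal_add,
    Complex.norm_real, Real.norm_of_nonneg (by positivity)]
  exact mul_le_mul_of_nonneg_right (hC m) (norm_nonneg _)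

theorem coeff_laplacian (q : sobolevTwo d) (m : Fin d → ℤ) :
    coeff (laplacian d q) m = -((m ⬝ᵥ m : ℤ) : ℂ) * coeff (q : L2Torus d) m :=
  coeff_fourierMultiplier _ q m

theorem coeff_dotGradient (k : Fin d → ℤ) (q : sobolevTwo d) (m : Fin d → ℤ) :
    coeff (dotGradient k q) m = Complex.I * ((k ⬝ᵥ m : ℤ) : ℂ) * coeff (q : L2Torus d) m :=
  coeff_fourierMultiplier _ q m

theorem characterL2_mem_sobolevTwo (l : Fin d → ℤ) : characterL2 l ∈ sobolevTwo d := by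
  refine mem_sobolevTwo_iff.mpr (summable_of_ne_finset_zero (s := {l}) fun m hm => ?_)
  rw [coeff_characterL2, if_neg (Finset.notMem_singleton.mp hm), mul_zero, norm_zero, zero_pow
    two_ne_zero]

theorem summable_boundedMultiplier {a : (Fin d → ℤ) → ℂ} (ha : BddAbove (Set.range fun m => ‖a m‖))
    (q : L2Torus d) : Summable fun m => (a m * coeff q m) • characterL2 m := by
  obtain ⟨C, hC⟩ := ha
  refine summable_smul_characterL2
    (summable_norm_sq_of_norm_le_mul (C := C) (summable_norm_coeff_sq q) fun m => ?_)
  rw [norm_mul]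
  exact mul_le_mul_of_nonneg_right (hC ⟨m, rfl⟩) (norm_nonneg _)

/-- The operator `∑ q_m exp (i m · x) ↦ ∑ a(m) q_m exp (i m · x)` on `L²(𝕋^d)`, for a bounded
symbol `a`; unlike `fourierMultiplier`, it is defined on all of `L²(𝕋^d)`. -/
def boundedMultiplier (a : (Fin d → ℤ) → ℂ) (ha : BddAbove (Set.range fun m => ‖a m‖)) :
    L2Torus d →L[ℂ] L2Torus d :=
  have coeff_sum := fun q => coeff_tsum_smul_characterL2 (summable_boundedMultiplier ha q)
  let T : L2Torus d →ₗ[ℂ] L2Torus d :=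
    { toFun := fun q => ∑' m, (a m * coeff q m) • characterL2 m
      map_add' := fun q r => L2Torus_ext_coeff fun m => by
        rw [coeff_add, coeff_sum, coeff_sum, coeff_sum, coeff_add, mul_add]
      map_smul' := fun t q => L2Torus_ext_coeff fun m => by
        rw [RingHom.id_apply, coeff_smul, coeff_sum, coeff_sum, coeff_smul, mul_left_comm] }
  have coeff_T : ∀ q m, coeff (T q) m = a m * coeff q m := coeff_sum
  { toLinearMap := T
    cont := T.continuous_of_seq_closed_graph fun u q r hu hTu => L2Torus_ext_coeff fun m => by
      have hr := ((coeffCLM m).continuous.tendsto r).comp hTu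
      have hq := (((coeffCLM m).continuous.tendsto q).comp hu).const_mul (a m)
      simp only [Function.comp_def, coeffCLM_apply, coeff_T] at hr hq
      rw [coeff_T]
      exact tendsto_nhds_unique hr hq }

theorem coeff_boundedMultiplier {a : (Fin d → ℤ) → ℂ} (ha : BddAbove (Set.range fun m => ‖a m‖))
    (q : L2Torus d) (m : Fin d → ℤ) : coeff (boundedMultiplier a ha q) m = a m * coeff q m :=
  coeff_tsum_smul_characterL2 (summable_boundedMultiplier ha q) m

theorem boundedMultiplier_mem_sobolevTwo {a : (Fin d → ℤ) → ℂ}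
    (ha : BddAbove (Set.range fun m => ‖a m‖))
    (ha' : BddAbove (Set.range fun m : Fin d → ℤ => ‖(1 + ((m ⬝ᵥ m : ℤ) : ℝ)) * a m‖))
    (q : L2Torus d) : boundedMultiplier a ha q ∈ sobolevTwo d := by
  obtain ⟨C, hC⟩ := ha'
  refine mem_sobolevTwo_iff.mpr
    (summable_norm_sq_of_norm_le_mul (C := C) (summable_norm_coeff_sq q) fun m => ?_)
  rw [coeff_boundedMultiplier, ← mul_assoc, norm_mul]
  exact mul_le_mul_of_nonneg_right (hC ⟨m, rfl⟩) (norm_nonneg _)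

end Multiplier

/-! ### Convolution and coupling -/

section Coupling

variable {d n : ℕ}

theorem norm_two_pi_pow_mul_coeff_le (f : Torus d → ℂ) (m : Fin d → ℤ) :
    ‖(2 * Real.pi : ℂ) ^ d * coeff f m‖ ≤ ∫ x, ‖f x‖ := by
  rw [← integral_mul_character_neg]
  refine (norm_integral_le_integral_norm _).trans_eq (integral_congr_ae (.of_forall fun x => ?_))
  beta_reduce
  rw [norm_mul, norm_character_apply, mul_one]

theorem conj_coeff_ofReal_of_even {f : Torus d → ℝ} (hf : ∀ x, f (-x) = f x) (m : Fin d → ℤ) :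
    conj (coeff (fun x => (f x : ℂ)) m) = coeff (fun x => (f x : ℂ)) m := by
  have : (volume : Measure (Torus d)).IsNegInvariant :=
    Measure.IsAddHaarMeasure.isNegInvariant_of_regular _
  unfold coeff
  rw [map_mul, ← integral_conj, ← integral_neg_eq_self]
  congr 1
  · simp [Complex.conj_ofNat]
  · refine integral_congr_ae (.of_forall fun x => ?_)
    beta_reduce
    rw [map_mul, Complex.conj_ofReal, hf, ← character_neg, neg_neg, character_apply_neg]

theorem two_pi_pow_mul_coeff_ofReal_zero (f : Torus d → ℝ) :
    (2 * Real.pi : ℂ) ^ d * coeff (fun x => (f x : ℂ)) 0 = ((∫ x, f x : ℝ) : ℂ) := by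
  rw [← integral_mul_character_neg, ← integral_complex_ofReal, neg_zero, character_zero]
  simp only [ContinuousMap.one_apply, mul_one]

theorem integrable_prod_convolution (σ : C(Torus d, ℝ)) (q : L2Torus d) (m : Fin d → ℤ) :
    Integrable (Function.uncurry fun x y : Torus d => (σ (x - y) : ℂ) * q y * character m x)
      (volume.prod volume) := by
  have hq : Integrable (fun z : Torus d × Torus d => q z.2) (volume.prod volume) :=
    ((Lp.memLp q).integrable one_le_two).comp_snd _
  have hσ : Continuous fun z : Torus d × Torus d => (σ (z.1 - z.2) : ℂ) * character m z.1 := by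
    fun_prop
  refine (hq.bdd_mul (c := ‖σ‖) hσ.aestronglyMeasurable (.of_forall fun z => ?_)).congr
    (.of_forall fun z => mul_right_comm _ _ _)
  rw [norm_mul, norm_character_apply, mul_one, Complex.norm_real]
  exact σ.norm_coe_le_norm _

theorem coeff_convolution (σ : C(Torus d, ℝ)) (q : L2Torus d) (m : Fin d → ℤ) :
    coeff (convolution σ q) m
      = (2 * Real.pi : ℂ) ^ d * coeff (fun x => (σ x : ℂ)) m * coeff q m := by
  have integral_translate : ∀ y : Torus d, ∫ x, (σ (x - y) : ℂ) * q y * character (-m) x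
      = (∫ x, (σ x : ℂ) * character (-m) x) * (q y * character (-m) y) := fun y => by
    rw [← integral_add_right_eq_self _ y, ← integral_mul_const]
    refine integral_congr_ae (.of_forall fun x => ?_)
    beta_reduce
    rw [add_sub_cancel_right, character_apply_add]
    ring
  refine mul_left_cancel₀ (two_pi_pow_ne_zero d) ?_
  calc (2 * Real.pi : ℂ) ^ d * coeff (convolution σ q) m
      = ∫ x, (convolution σ q : L2Torus d) x * character (-m) x :=
        (integral_mul_character_neg _ m).symm
    _ = ∫ x, ∫ y, (σ (x - y) : ℂ) * q y * character (-m) x := by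
        apply integral_congr_ae
        filter_upwards [MemLp.coeFn_toLp ((continuous_convolution σ q).memLp_of_hasCompactSupport
          (HasCompactSupport.of_compactSpace _) : MemLp _ 2 volume)] with x hx
        rw [integral_mul_const]
        exact congrArg (· * character (-m) x) hx
    _ = ∫ y, ∫ x, (σ (x - y) : ℂ) * q y * character (-m) x :=
        integral_integral_swap (integrable_prod_convolution σ q (-m))
    _ = (2 * Real.pi : ℂ) ^ d * ((2 * Real.pi : ℂ) ^ d * coeff (fun x => (σ x : ℂ)) m
          * coeff q m) := by
        simp_rw [integral_translate]
        rw [integral_const_mul, integral_mul_character_neg, integral_mul_character_neg]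
        ring

theorem fieldAverage_tensorField (S : L2Space n) (f : L2Torus d) :
    fieldAverage S (tensorField S f) = (∫ z, S z * S z) • f := by
  apply Lp.ext
  filter_upwards [(pairing S).coeFn_compLpL (p := 2) (μ := volume) (tensorField S f),
    (ContinuousLinearMap.toSpanSingleton ℂ S).coeFn_compLpL (p := 2) (μ := volume) f,
    Lp.coeFn_smul (∫ z, S z * S z) f] with x hpairing htensor hsmul
  rw [hsmul, fieldAverage, hpairing, tensorField, htensor,
    ContinuousLinearMap.toSpanSingleton_apply, map_smul, Pi.smul_apply, smul_eq_mul, smul_eq_mul,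
    mul_comm]
  rfl

/-- The symbol `m ↦ (γ (2π)^d σ_m)² ∫ S²` of the operator `γ² σ ⋆ ∫ S (S (σ ⋆ ·)) dz` through which
the field `φ` acts back on `q`. For `S = (-Δ)^{-1/2} σ₂` the integral is `κ`. -/
def couplingSymbol (γ : ℝ) (σ : C(Torus d, ℝ)) (S : L2Space n) (m : Fin d → ℤ) : ℂ :=
  (γ * ((2 * Real.pi : ℂ) ^ d * coeff (fun x => (σ x : ℂ)) m)) ^ 2 * ∫ z, S z * S z

theorem bddAbove_norm_couplingSymbol (γ : ℝ) (σ : C(Torus d, ℝ)) (S : L2Space n) :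
    BddAbove (Set.range fun m => ‖couplingSymbol γ σ S m‖) := by
  refine ⟨(|γ| * ∫ x, ‖(σ x : ℂ)‖) ^ 2 * ‖∫ z, S z * S z‖, ?_⟩
  rintro _ ⟨m, rfl⟩
  beta_reduce
  rw [couplingSymbol, norm_mul, norm_pow, norm_mul, Complex.norm_real, Real.norm_eq_abs]
  gcongr
  exact norm_two_pi_pow_mul_coeff_le _ m

theorem coeff_convolution_fieldAverage_tensorField (γ : ℝ) (σ : C(Torus d, ℝ)) (S : L2Space n)
    (q : L2Torus d) (m : Fin d → ℤ) :
    γ ^ 2 * coeff (convolution σ (fieldAverage S (tensorField S (convolution σ q)))) m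
      = couplingSymbol γ σ S m * coeff q m := by
  rw [fieldAverage_tensorField, coeff_convolution, coeff_smul, coeff_convolution, couplingSymbol]
  ring

end Coupling

section InfiniteDimensional

theorem not_finiteDimensional_Lp_of_pairwise_disjoint {ι α : Type*} [Infinite ι]
    [MeasurableSpace α] {μ : Measure α} {s : ι → Set α} (hs : ∀ i, MeasurableSet (s i))
    (hdisj : Pairwise (Function.onFun Disjoint s)) (hpos : ∀ i, μ (s i) ≠ 0)
    (hfin : ∀ i, μ (s i) ≠ ⊤) : ¬ FiniteDimensional ℂ (Lp ℂ 2 μ) := by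
  intro _
  have hinner : ∀ i j, inner ℂ (indicatorConstLp 2 (hs i) (hfin i) (1 : ℂ))
      (indicatorConstLp 2 (hs j) (hfin j) (1 : ℂ)) = (μ.real (s i ∩ s j) : ℂ) := fun i j =>
    L2.inner_indicatorConstLp_one_indicatorConstLp_one (hs i) (hs j) (hfin i) (hfin j)
  have hli : LinearIndependent ℂ fun i => indicatorConstLp 2 (hs i) (hfin i) (1 : ℂ) := by
    refine linearIndependent_of_ne_zero_of_inner_eq_zero (𝕜 := ℂ) (fun i hi => ?_)
      (fun i j hij => ?_)
    · have hii := hinner i i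
      rw [hi, inner_zero_left, Set.inter_self] at hii
      exact (ENNReal.toReal_pos (hpos i) (hfin i)).ne (by exact_mod_cast hii)
    · beta_reduce
      rw [hinner, (hdisj hij).inter_eq, measureReal_empty, Complex.ofReal_zero]
  have := hli.finite
  exact not_finite ι

theorem not_finiteDimensional_L2Space {n : ℕ} (hn : 0 < n) :
    ¬ FiniteDimensional ℂ (L2Space n) := by
  let center : ℤ → EuclideanSpace ℝ (Fin n) := fun j => EuclideanSpace.single ⟨0, hn⟩ (j : ℝ)
  refine not_finiteDimensional_Lp_of_pairwise_disjoint
    (s := fun j => Metric.ball (center j) (1 / 2)) (fun _ => measurableSet_ball)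
    (fun i j hij => Metric.ball_disjoint_ball ?_)
    (fun _ => (Metric.measure_ball_pos volume _ (by norm_num)).ne')
    (fun _ => measure_ball_lt_top.ne)
  rw [PiLp.dist_single_same, Real.dist_eq, add_halves]
  exact_mod_cast Int.one_le_abs (sub_ne_zero.mpr hij)

theorem Lp_const_injective {α E : Type*} [MeasurableSpace α] [NormedAddCommGroup E]
    (μ : Measure α) [IsFiniteMeasure μ] [NeZero μ] {p : ENNReal} [Fact (1 ≤ p)] :
    Function.Injective (Lp.const p μ : E → Lp E p μ) := by
  refine (injective_iff_map_eq_zero _).mpr fun c hc => norm_eq_zero.mp ?_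
  have hnorm := Lp.norm_const (p := p) (μ := μ) (c := c)
    (zero_lt_one.trans_le Fact.out).ne'
  rw [hc, norm_zero] at hnorm
  exact (mul_eq_zero.mp hnorm.symm).resolve_right
    (Real.rpow_pos_of_pos measureReal_univ_pos _).ne'

theorem not_finiteDimensional_L2Field (d : ℕ) {n : ℕ} (hn : 0 < n) :
    ¬ FiniteDimensional ℂ (L2Field d n) := fun _ =>
  not_finiteDimensional_L2Space hn (FiniteDimensional.of_injective
    (Lp.constₗ 2 (volume : Measure (Torus d)) ℂ (E := L2Space n))
    (Lp_const_injective volume))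

end InfiniteDimensional

/-! ### Reality of `(-Δ)^{-1/2} σ₂` -/

section ConjReflection

theorem continuous_star_Lp {α : Type*} [MeasurableSpace α] (μ : Measure α) :
    Continuous (star : Lp ℂ 2 μ → Lp ℂ 2 μ) := by
  have star_eq : (star : Lp ℂ 2 μ → Lp ℂ 2 μ)
      = (Complex.conjCLE : ℂ →L[ℝ] ℂ).compLpL 2 μ := by
    funext f
    apply Lp.ext
    filter_upwards [Lp.coeFn_star f, (Complex.conjCLE : ℂ →L[ℝ] ℂ).coeFn_compLpL (p := 2) f]
      with z hstar hconj
    rw [hstar, hconj]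
    rfl
  rw [star_eq]
  exact ContinuousLinearMap.continuous _

variable {V : Type*} [NormedAddCommGroup V] [InnerProductSpace ℝ V] [FiniteDimensional ℝ V]
  [MeasurableSpace V] [BorelSpace V]

/-- The involution `f ↦ conj (f (-·))` of `L²(V)`, which the Fourier transform turns into complex
conjugation. -/
def conjReflection (f : Lp ℂ 2 (volume : Measure V)) : Lp ℂ 2 (volume : Measure V) :=
  star (Lp.compMeasurePreserving (fun z : V => -z) (Measure.measurePreserving_neg volume) f)

theorem coeFn_conjReflection_of_ae_eq {f : Lp ℂ 2 (volume : Measure V)} {g : V → ℂ}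
    (hfg : f =ᵐ[volume] g) : conjReflection f =ᵐ[volume] fun z => conj (g (-z)) := by
  have hneg := Measure.measurePreserving_neg (volume : Measure V)
  filter_upwards [Lp.coeFn_star (Lp.compMeasurePreserving (fun z : V => -z) hneg f),
    Lp.coeFn_compMeasurePreserving f hneg, hneg.quasiMeasurePreserving.ae hfg]
    with z hstar hcomp hz
  rw [conjReflection, hstar, Pi.star_apply, hcomp, Function.comp_apply, hz]
  rfl

theorem continuous_conjReflection :
    Continuous (conjReflection : Lp ℂ 2 (volume : Measure V) → Lp ℂ 2 (volume : Measure V)) :=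
  (continuous_star_Lp volume).comp
    (Lp.isometry_compMeasurePreserving (Measure.measurePreserving_neg volume)).continuous

theorem conj_fourierInv (g : V → ℂ) (w : V) :
    conj (𝓕⁻ g w) = 𝓕⁻ (fun z => conj (g (-z))) w := by
  rw [Real.fourierInv_eq', Real.fourierInv_eq', ← integral_conj, ← integral_neg_eq_self]
  congr 1
  ext v
  simp only [smul_eq_mul, map_mul, ← Complex.exp_conj, Complex.conj_ofReal, Complex.conj_I,
    inner_neg_left, Complex.ofReal_neg, map_neg, mul_neg, neg_mul,
    neg_neg]

theorem conj_fourier (g : V → ℂ) (w : V) : conj (𝓕 g w) = 𝓕 (fun z => conj (g z)) (-w) := by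
  rw [Real.fourier_eq', Real.fourier_eq', ← integral_conj]
  congr 1
  ext v
  simp only [smul_eq_mul, map_mul, ← Complex.exp_conj, Complex.conj_ofReal, Complex.conj_I,
    inner_neg_right, Complex.ofReal_neg, map_neg, mul_neg, neg_mul,
    neg_neg]

theorem conjReflection_toLp (g : SchwartzMap V ℂ) :
    ∃ h : SchwartzMap V ℂ, (∀ z, h z = conj (g (-z))) ∧ conjReflection (g.toLp 2) = h.toLp 2 := by
  let h : SchwartzMap V ℂ := (SchwartzMap.compCLMOfContinuousLinearEquiv ℝ
    (ContinuousLinearEquiv.neg ℝ (M := V)) g).postcompCLM (Complex.conjCLE : ℂ →L[ℝ] ℂ)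
  exact ⟨h, fun _ => rfl, Lp.ext ((coeFn_conjReflection_of_ae_eq (g.coeFn_toLp 2 volume)).trans
    (h.coeFn_toLp 2 volume).symm)⟩

theorem star_fourierInv (f : Lp ℂ 2 (volume : Measure V)) :
    star (𝓕⁻ f) = 𝓕⁻ (conjReflection f) := by
  refine DenseRange.induction_on
    (SchwartzMap.denseRange_toLpCLM (E := V) (F := ℂ) (p := 2) (μ := volume)
      ENNReal.ofNat_ne_top) f ?_ fun g => ?_
  · have continuous_fourierInv : Continuous fun f : Lp ℂ 2 (volume : Measure V) => 𝓕⁻ f :=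
      (Lp.fourierTransformₗᵢ V ℂ).symm.continuous
    exact isClosed_eq ((continuous_star_Lp volume).comp continuous_fourierInv)
      (continuous_fourierInv.comp continuous_conjReflection)
  · obtain ⟨h, hg, hLp⟩ := conjReflection_toLp g
    rw [SchwartzMap.toLpCLM_apply, hLp, SchwartzMap.toLp_fourierInv_eq,
      SchwartzMap.toLp_fourierInv_eq]
    apply Lp.ext
    filter_upwards [Lp.coeFn_star ((𝓕⁻ g).toLp 2), (𝓕⁻ g).coeFn_toLp 2 volume,
      (𝓕⁻ h).coeFn_toLp 2 volume] with z hstar hz hz'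
    rw [hstar, Pi.star_apply, hz, hz', SchwartzMap.fourierInv_coe, SchwartzMap.fourierInv_coe,
      funext hg]
    exact conj_fourierInv _ _

end ConjReflection

section Riesz

variable {n : ℕ} (σ₂ : EuclideanSpace ℝ (Fin n) → ℝ)

theorem conj_rieszSymbol_neg (ξ : EuclideanSpace ℝ (Fin n)) :
    conj (rieszSymbol σ₂ (-ξ)) = rieszSymbol σ₂ ξ := by
  simp only [rieszSymbol, map_div₀, Complex.conj_ofReal, norm_neg, conj_fourier, neg_neg]

theorem star_invSqrtLaplacian (h : MemLp (rieszSymbol σ₂) 2 volume) :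
    star (invSqrtLaplacian σ₂ h) = invSqrtLaplacian σ₂ h := by
  have conjReflection_rieszSymbol : conjReflection (h.toLp (rieszSymbol σ₂)) = h.toLp _ := by
    apply Lp.ext
    filter_upwards [coeFn_conjReflection_of_ae_eq h.coeFn_toLp, h.coeFn_toLp] with ξ hconj hξ
    rw [hconj, hξ, conj_rieszSymbol_neg]
  rw [invSqrtLaplacian, star_fourierInv, conjReflection_rieszSymbol]

theorem norm_invSqrtLaplacian_sq (h : MemLp (rieszSymbol σ₂) 2 volume) :
    ‖invSqrtLaplacian σ₂ h‖ ^ 2 = kappa σ₂ := by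
  have plancherel : ‖invSqrtLaplacian σ₂ h‖ = ‖h.toLp (rieszSymbol σ₂)‖ :=
    (Lp.fourierTransformₗᵢ (EuclideanSpace ℝ (Fin n)) ℂ).symm.norm_map _
  rw [plancherel, ← @inner_self_eq_norm_sq ℂ, L2.inner_def, kappa,
    ← integral_re (L2.integrable_inner _ _)]
  apply integral_congr_ae
  filter_upwards [h.coeFn_toLp] with z hz
  rw [inner_self_eq_norm_sq, hz]

theorem integral_invSqrtLaplacian_mul_self (h : MemLp (rieszSymbol σ₂) 2 volume) :
    ∫ z, invSqrtLaplacian σ₂ h z * invSqrtLaplacian σ₂ h z = (kappa σ₂ : ℂ) := by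
  rw [integral_mul_eq_inner, star_invSqrtLaplacian, inner_self_eq_norm_sq_to_K,
    ← norm_invSqrtLaplacian_sq σ₂ h, Complex.ofReal_pow]
  rfl

theorem kappa_pos (hn : 0 < n) (h : MemLp (rieszSymbol σ₂) 2 volume)
    (h0 : ∀ ξ, 𝓕 (fun z => (σ₂ z : ℂ)) ξ ≠ 0) : 0 < kappa σ₂ := by
  have : Nonempty (Fin n) := ⟨⟨0, hn⟩⟩
  rw [kappa, integral_pos_iff_support_of_nonneg (fun ξ => sq_nonneg _)
    ((memLp_two_iff_integrable_sq_norm h.1).mp h)]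
  refine (isOpen_compl_singleton.measure_pos volume
    (exists_ne (0 : EuclideanSpace ℝ (Fin n)))).trans_le (measure_mono fun ξ hξ => ?_)
  refine pow_ne_zero _ (norm_ne_zero_iff.mpr (div_ne_zero (h0 ξ) (Complex.ofReal_ne_zero.mpr ?_)))
  exact mul_ne_zero Real.two_pi_pos.ne' (norm_ne_zero_iff.mpr hξ)

end Riesz

/-! ### The reduced symbol -/

section ReducedSymbol

theorem finrank_ker_mulVecLin_eq_one {F : Type*} [Field F] {M : Matrix (Fin 2) (Fin 2) F}
    (hM : M ≠ 0) (hdet : M.det = 0) : Module.finrank F (LinearMap.ker M.mulVecLin) = 1 := by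
  have rank_nullity := M.mulVecLin.finrank_range_add_finrank_ker
  have rank_pos : 0 < Module.finrank F (LinearMap.range M.mulVecLin) := by
    rw [Module.finrank_pos_iff, Submodule.nontrivial_iff_ne_bot, Ne, LinearMap.range_eq_bot]
    exact fun h => hM (Matrix.mulVec_injective (funext fun v =>
      (LinearMap.congr_fun h v).trans (Matrix.zero_mulVec v).symm))
  have nullity_pos : 0 < Module.finrank F (LinearMap.ker M.mulVecLin) := by
    obtain ⟨v, hv, hMv⟩ := Matrix.exists_mulVec_eq_zero_iff.mpr hdet
    exact Module.finrank_pos_iff_exists_ne_zero.mpr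
      ⟨⟨v, hMv⟩, fun h => hv (congrArg Subtype.val h)⟩
  rw [Module.finrank_fin_fun] at rank_nullity
  lia

/-- The Schur complement, after elimination of the fields, of the matrix of `𝓛 - μ` on a Fourier
mode `m`, where `a = m²`, `b = k · m` and `t` is the strength of the coupling of the mode. -/
def modeMatrix (a b t μ : ℂ) : Matrix (Fin 2) (Fin 2) ℂ :=
  !![a / 2 - μ - t / (1 / 2 - μ), Complex.I * b; -(Complex.I * b), a / 2 - μ]

theorem det_modeMatrix (a b t μ : ℂ) : (modeMatrix a b t μ).det =
    (a / 2 - μ - t / (1 / 2 - μ)) * (a / 2 - μ) - b ^ 2 := by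
  rw [modeMatrix, Matrix.det_fin_two_of]
  linear_combination b ^ 2 * Complex.I_sq

theorem finite_setOf_det_modeMatrix_eq_zero (a b t : ℂ) :
    {μ | μ ≠ 1 / 2 ∧ (modeMatrix a b t μ).det = 0}.Finite := by
  let unreduced : Matrix (Fin 3) (Fin 3) ℂ :=
    !![a / 2, Complex.I * b, t; -(Complex.I * b), a / 2, 0; 1, 0, 1 / 2]
  refine (Polynomial.finite_setOfPred_isRoot unreduced.charpoly_monic.ne_zero).subset ?_
  rintro μ ⟨hμ, hdet⟩
  have schur : unreduced.charpoly.eval μ = -((1 / 2 - μ) * (modeMatrix a b t μ).det) := by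
    have hμ' : 1 / 2 - μ ≠ 0 := sub_ne_zero.mpr hμ.symm
    have hdiv : (1 / 2 - μ) * (t / (1 / 2 - μ)) = t := mul_div_cancel₀ t hμ'
    rw [Matrix.eval_charpoly, det_modeMatrix, Matrix.det_fin_three]
    simp only [unreduced, Matrix.scalar_apply, Matrix.sub_apply, Matrix.diagonal_apply_eq,
      Matrix.of_apply, Matrix.cons_val', Matrix.cons_val_zero, Matrix.cons_val_fin_one,
      Matrix.cons_val_one, Matrix.cons_val, ne_eq, Fin.isValue, Fin.reduceEq, not_false_eq_true,
      Matrix.diagonal_apply_ne, zero_ne_one, one_ne_zero]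
    linear_combination (μ - a / 2) * hdiv - (1 / 2 - μ) * b ^ 2 * Complex.I_sq
  rw [Set.mem_ofPred_eq, Polynomial.IsRoot, schur, hdet, mul_zero, neg_zero]

theorem smul_modeMatrix {a r : ℂ} (hr : r * (1 + a) = 1) (b t μ : ℂ) : r • modeMatrix a b t μ =
    !![1 / 2 - r * (1 / 2 + μ) - r * t * (1 / 2 - μ)⁻¹, Complex.I * (r * b);
      -(Complex.I * (r * b)), 1 / 2 - r * (1 / 2 + μ)] := by
  rw [modeMatrix, div_eq_mul_inv t]
  ext i j
  fin_cases i <;> fin_cases j <;> simp only [Matrix.smul_apply, smul_eq_mul, Matrix.of_apply,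
    Matrix.cons_val', Matrix.cons_val_zero, Matrix.cons_val_one, Matrix.cons_val_fin_one,
    Fin.zero_eta, Fin.mk_one]
  · linear_combination hr / 2
  · ring
  · ring
  · linear_combination hr / 2

variable {d : ℕ}

/-- The matrix `modeMatrix` of the mode `m`, for the coupling strengths `T`. -/
def reducedSymbol (k : Fin d → ℤ) (T : (Fin d → ℤ) → ℂ) (m : Fin d → ℤ) (μ : ℂ) :
    Matrix (Fin 2) (Fin 2) ℂ :=
  modeMatrix (m ⬝ᵥ m : ℤ) (k ⬝ᵥ m : ℤ) (T m) μ

theorem dotProduct_sq_le {ι : Type*} [Fintype ι] (k m : ι → ℤ) :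
    ((k ⬝ᵥ m : ℤ) : ℝ) ^ 2 ≤ ((k ⬝ᵥ k : ℤ) : ℝ) * ((m ⬝ᵥ m : ℤ) : ℝ) := by
  have h := Finset.sum_mul_sq_le_sq_mul_sq Finset.univ k m
  simp only [sq, ← dotProduct.eq_1] at h ⊢
  exact_mod_cast h

theorem tendsto_inv_one_add_dotProduct_self_cofinite :
    Tendsto (fun m : Fin d → ℤ => (1 + ((m ⬝ᵥ m : ℤ) : ℝ) : ℂ)⁻¹) cofinite (𝓝 0) := by
  have h := tendsto_inv_atTop_zero.comp
    (tendsto_atTop_add_const_left cofinite 1 (tendsto_dotProduct_self_cofinite (ι := Fin d)))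
  simpa [Function.comp_def] using (Complex.continuous_ofReal.tendsto 0).comp h

theorem tendsto_inv_one_add_dotProduct_self_mul_dotProduct (k : Fin d → ℤ) :
    Tendsto (fun m : Fin d → ℤ => (1 + ((m ⬝ᵥ m : ℤ) : ℝ) : ℂ)⁻¹ * (k ⬝ᵥ m : ℤ)) cofinite
      (𝓝 0) := by
  have bound : Tendsto (fun m : Fin d → ℤ =>
      √(((k ⬝ᵥ k : ℤ) : ℝ) * ‖(1 + ((m ⬝ᵥ m : ℤ) : ℝ) : ℂ)⁻¹‖)) cofinite (𝓝 0) := by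
    simpa using (tendsto_inv_one_add_dotProduct_self_cofinite.norm.const_mul _).sqrt
  refine squeeze_zero_norm (fun m => Real.le_sqrt_of_sq_le ?_) bound
  have hm := dotProduct_self_nonneg_real m
  have hk := dotProduct_self_nonneg_real k
  rw [norm_mul, mul_pow, Complex.norm_intCast, sq_abs, norm_inv, ← Complex.ofReal_one,
    ← Complex.ofReal_add, Complex.norm_real, Real.norm_of_nonneg (by positivity)]
  field_simp
  nlinarith [dotProduct_sq_le k m]

variable {k : Fin d → ℤ} {T : (Fin d → ℤ) → ℂ} {μ : ℂ}

theorem one_add_dotProduct_self_ne_zero (m : Fin d → ℤ) : (1 + ((m ⬝ᵥ m : ℤ) : ℝ) : ℂ) ≠ 0 := by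
  have hm := dotProduct_self_nonneg_real m
  exact_mod_cast (by positivity : (1 + ((m ⬝ᵥ m : ℤ) : ℝ)) ≠ 0)

theorem tendsto_inv_smul_reducedSymbol (hT : BddAbove (Set.range fun m => ‖T m‖))
    (hμ : μ ≠ 1 / 2) :
    Tendsto (fun x : (Fin d → ℤ) × ℂ =>
      (1 + ((x.1 ⬝ᵥ x.1 : ℤ) : ℝ) : ℂ)⁻¹ • reducedSymbol k T x.1 x.2) (cofinite ×ˢ 𝓝 μ)
      (𝓝 !![1 / 2, 0; 0, 1 / 2]) := by
  have fst_tendsto : Tendsto Prod.fst (cofinite ×ˢ 𝓝 μ) (cofinite : Filter (Fin d → ℤ)) :=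
    tendsto_fst
  have snd_tendsto : Tendsto Prod.snd ((cofinite : Filter (Fin d → ℤ)) ×ˢ 𝓝 μ) (𝓝 μ) :=
    tendsto_snd
  have diagonal := ((tendsto_inv_one_add_dotProduct_self_cofinite.comp fst_tendsto).mul
    (snd_tendsto.const_add (1 / 2))).const_sub (1 / 2)
  have off_diagonal := ((tendsto_inv_one_add_dotProduct_self_mul_dotProduct k).comp
    fst_tendsto).const_mul Complex.I
  have coupling := ((tendsto_inv_one_add_dotProduct_self_cofinite.zero_mul_isBoundedUnder_le
    hT.isBoundedUnder_of_range).comp fst_tendsto).mul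
      ((snd_tendsto.const_sub (1 / 2)).inv₀ (sub_ne_zero.mpr hμ.symm))
  have entry_zero_zero := diagonal.sub coupling
  have entry_one_zero := off_diagonal.neg
  simp only [zero_mul, mul_zero, sub_zero] at diagonal off_diagonal entry_zero_zero
  rw [mul_zero, neg_zero] at entry_one_zero
  refine Tendsto.congr (fun x => (smul_modeMatrix (inv_mul_cancel₀
    (one_add_dotProduct_self_ne_zero x.1)) (k ⬝ᵥ x.1 : ℤ) (T x.1) x.2).symm) ?_
  exact tendsto_pi_nhds.mpr (Fin.forall_fin_two.mpr
    ⟨tendsto_pi_nhds.mpr (Fin.forall_fin_two.mpr ⟨entry_zero_zero, off_diagonal⟩),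
      tendsto_pi_nhds.mpr (Fin.forall_fin_two.mpr ⟨entry_one_zero, diagonal⟩)⟩)

theorem eventually_det_reducedSymbol_ne_zero (hT : BddAbove (Set.range fun m => ‖T m‖))
    (hμ : μ ≠ 1 / 2) :
    ∀ᶠ x in cofinite ×ˢ 𝓝 μ, (reducedSymbol k T x.1 x.2).det ≠ 0 := by
  have det_tendsto := (continuous_id.matrix_det.tendsto _).comp
    (tendsto_inv_smul_reducedSymbol (k := k) hT hμ)
  have limit_ne_zero : (!![1 / 2, 0; 0, 1 / 2] : Matrix (Fin 2) (Fin 2) ℂ).det ≠ 0 := by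
    simp [Matrix.det_fin_two_of]
  filter_upwards [det_tendsto.eventually_ne limit_ne_zero] with x hx hdet
  exact hx (by simp only [Function.comp_apply, id, Matrix.det_smul, hdet, mul_zero])

/-- The Fourier modes on which the reduced symbol at `μ` is singular. -/
def singularModes (k : Fin d → ℤ) (T : (Fin d → ℤ) → ℂ) (μ : ℂ) : Set (Fin d → ℤ) :=
  {m | (reducedSymbol k T m μ).det = 0}

theorem finite_singularModes (hT : BddAbove (Set.range fun m => ‖T m‖)) (hμ : μ ≠ 1 / 2) :
    (singularModes k T μ).Finite := by
  have h := (eventually_det_reducedSymbol_ne_zero (k := k) hT hμ).curry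
  simpa [singularModes] using h.mono fun m hm => hm.self_of_nhds

theorem eventually_singularModes_eq_empty (hT : BddAbove (Set.range fun m => ‖T m‖))
    (hμ : μ ≠ 1 / 2) : ∀ᶠ ν in 𝓝[≠] μ, singularModes k T ν = ∅ := by
  obtain ⟨p, hp, r, hr, hpr⟩ := eventually_prod_iff.mp
    (eventually_det_reducedSymbol_ne_zero (k := k) hT hμ)
  have each_mode : ∀ m, ∀ᶠ ν in 𝓝[≠] μ, ν ≠ 1 / 2 → (reducedSymbol k T m ν).det ≠ 0 := fun m =>
    ((finite_setOf_det_modeMatrix_eq_zero _ _ _).eventually_cofinite_notMem.filter_mono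
      (nhdsNE_le_cofinite μ)).mono fun ν hν hν' hdet => hν ⟨hν', hdet⟩
  have exceptional_modes := (eventually_all_finite (I := {m | ¬p m}) hp).mpr fun m _ => each_mode m
  filter_upwards [exceptional_modes, eventually_nhdsWithin_of_eventually_nhds hr,
    eventually_nhdsWithin_of_eventually_nhds (eventually_ne_nhds hμ)] with ν hfin hrν hν
  refine Set.eq_empty_iff_forall_notMem.mpr fun m => ?_
  by_cases hm : p m
  exacts [hpr hm hrν, hfin m hm hν]

theorem bddAbove_norm_one_add_mul_inv_reducedSymbol (hT : BddAbove (Set.range fun m => ‖T m‖))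
    (hμ : μ ≠ 1 / 2) (i j : Fin 2) : BddAbove (Set.range fun m =>
      ‖(1 + ((m ⬝ᵥ m : ℤ) : ℝ)) * (reducedSymbol k T m μ)⁻¹ i j‖) := by
  have slice : Tendsto (fun m : Fin d → ℤ => (m, μ)) cofinite (cofinite ×ˢ 𝓝 μ) :=
    tendsto_id.prodMk tendsto_const_nhds
  have inv_continuousAt :
      ContinuousAt Inv.inv (!![1 / 2, 0; 0, 1 / 2] : Matrix (Fin 2) (Fin 2) ℂ) := by
    refine continuousAt_matrix_inv _ ?_
    rw [Ring.inverse_eq_inv']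
    exact continuousAt_inv₀ (by simp [Matrix.det_fin_two_of])
  have inv_tendsto := inv_continuousAt.tendsto.comp
    ((tendsto_inv_smul_reducedSymbol (k := k) hT hμ).comp slice)
  have entry_tendsto := (((continuous_apply_apply i j).tendsto _).comp inv_tendsto).norm
  refine (entry_tendsto.congr' ?_).bddAbove_range_of_cofinite
  filter_upwards [slice.eventually (eventually_det_reducedSymbol_ne_zero hT hμ)] with m hm
  have h := Matrix.inv_smul' (reducedSymbol k T m μ)
    (Units.mk0 _ (one_add_dotProduct_self_ne_zero m))⁻¹ (isUnit_iff_ne_zero.mpr hm)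
  rw [inv_inv] at h
  exact congrArg (fun M => ‖M i j‖) h

end ReducedSymbol

/-! ### Elimination of the fields -/

section Elimination

variable {d n : ℕ}

/-- The Fourier coefficients of a pair `(q, p)` at the mode `m`. -/
def pairCoeff (m : Fin d → ℤ) : WithLp 2 (L2Torus d × L2Torus d) →ₗ[ℂ] Fin 2 → ℂ where
  toFun v := ![coeff v.fst m, coeff v.snd m]
  map_add' _ _ := funext (Fin.forall_fin_two.mpr ⟨coeff_add _ _ _, coeff_add _ _ _⟩)
  map_smul' _ _ := funext (Fin.forall_fin_two.mpr ⟨coeff_smul _ _ _, coeff_smul _ _ _⟩)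

theorem pairCoeff_apply (m : Fin d → ℤ) (v : WithLp 2 (L2Torus d × L2Torus d)) :
    pairCoeff m v = ![coeff v.fst m, coeff v.snd m] :=
  rfl

theorem pairCoeff_ext {v w : WithLp 2 (L2Torus d × L2Torus d)}
    (h : ∀ m, pairCoeff m v = pairCoeff m w) : v = w :=
  WithLp.ofLp_injective _ (Prod.ext (L2Torus_ext_coeff fun m => congrFun (h m) 0)
    (L2Torus_ext_coeff fun m => congrFun (h m) 1))

theorem bddAbove_norm_two_pi_pow_mul_coeff (f : Torus d → ℂ) :
    BddAbove (Set.range fun m => ‖(2 * Real.pi : ℂ) ^ d * coeff f m‖) :=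
  ⟨_, Set.forall_mem_range.mpr (norm_two_pi_pow_mul_coeff_le f)⟩

/-- The convolution by `σ` as a continuous linear operator. -/
def convolutionCLM (σ : C(Torus d, ℝ)) : L2Torus d →L[ℂ] L2Torus d :=
  boundedMultiplier _ (bddAbove_norm_two_pi_pow_mul_coeff fun x => (σ x : ℂ))

theorem convolutionCLM_apply (σ : C(Torus d, ℝ)) (q : L2Torus d) :
    convolutionCLM σ q = convolution σ q :=
  L2Torus_ext_coeff fun m => by
    rw [convolutionCLM, coeff_boundedMultiplier, coeff_convolution]

/-- The operator into a Hilbert product with given components. -/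
def hilbertProd {E F G : Type*} [NormedAddCommGroup E] [NormedSpace ℂ E] [NormedAddCommGroup F]
    [NormedSpace ℂ F] [NormedAddCommGroup G] [NormedSpace ℂ G] (f : G →L[ℂ] E) (g : G →L[ℂ] F) :
    G →L[ℂ] WithLp 2 (E × F) :=
  (WithLp.prodContinuousLinearEquiv 2 ℂ E F).symm.toContinuousLinearMap ∘L f.prod g

/-- The right-hand side `(Y₁ - γ (1/2 - μ)⁻¹ σ ⋆ ∫ S Y₃ dz, Y₂)` of the equation on `(q, p)` left
by the elimination of `φ` from `(𝓛 - μ) (q, p, φ, π) = Y`. -/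
def reducedSource (γ : ℝ) (σ : C(Torus d, ℝ)) (S : L2Space n) (μ : ℂ) :
    StateSpace d n →L[ℂ] WithLp 2 (L2Torus d × L2Torus d) :=
  hilbertProd
    (WithLp.fstL 2 ℂ (L2Torus d) (L2Torus d) ∘L WithLp.fstL 2 ℂ _ _ - (γ * (1 / 2 - μ)⁻¹ : ℂ) •
      (convolutionCLM σ ∘L fieldAverage S ∘L WithLp.fstL 2 ℂ _ _ ∘L WithLp.sndL 2 ℂ _ _))
    (WithLp.sndL 2 ℂ (L2Torus d) (L2Torus d) ∘L WithLp.fstL 2 ℂ _ _)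

variable (k : Fin d → ℤ) (γ : ℝ) (σ : C(Torus d, ℝ)) (S : L2Space n) {μ : ℂ}

theorem reducedSource_apply (Y : StateSpace d n) : reducedSource γ σ S μ Y = WithLp.toLp 2
    (Y.fst.fst - (γ * (1 / 2 - μ)⁻¹ : ℂ) • convolution σ (fieldAverage S Y.snd.fst),
      Y.fst.snd) := by
  rw [← convolutionCLM_apply]
  rfl

theorem operatorL_sub_smul_apply (X : domainL d n) :
    operatorL k γ σ S X - μ • (X : StateSpace d n) = WithLp.toLp 2
      (WithLp.toLp 2
        (-((1 / 2 : ℂ) • laplacian d (compQ d n X)) + dotGradient k (compP d n X)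
            + (γ : ℂ) • convolution σ (fieldAverage S X.1.snd.fst) - μ • X.1.fst.fst,
          -((1 / 2 : ℂ) • laplacian d (compP d n X)) - dotGradient k (compQ d n X)
            - μ • X.1.fst.snd),
        WithLp.toLp 2
          ((1 / 2 - μ) • X.1.snd.fst + (γ : ℂ) • tensorField S (convolution σ X.1.fst.fst),
            (1 / 2 - μ) • X.1.snd.snd)) := by
  rw [sub_smul, sub_smul, ← add_sub_right_comm]
  rfl

theorem pairCoeff_reducedSource_operatorL (hμ : μ ≠ 1 / 2) (X : domainL d n) (m : Fin d → ℤ) :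
    pairCoeff m (reducedSource γ σ S μ (operatorL k γ σ S X - μ • (X : StateSpace d n))) =
      (reducedSymbol k (couplingSymbol γ σ S) m μ).mulVec (pairCoeff m X.1.fst) := by
  have hμ' : 1 / 2 - μ ≠ 0 := sub_ne_zero.mpr hμ.symm
  have coupling := coeff_convolution_fieldAverage_tensorField γ σ S X.1.fst.fst m
  have hq : (compQ d n X : L2Torus d) = X.1.fst.fst := rfl
  have hp : (compP d n X : L2Torus d) = X.1.fst.snd := rfl
  rw [operatorL_sub_smul_apply, reducedSource_apply, pairCoeff_apply, pairCoeff_apply,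
    reducedSymbol, modeMatrix, Matrix.mulVec_fin_two, div_eq_mul_inv (couplingSymbol γ σ S m)]
  simp only [WithLp.toLp_fst, WithLp.toLp_snd, Matrix.of_apply, Matrix.cons_val',
    Matrix.cons_val_zero, Matrix.cons_val_one, Matrix.cons_val_fin_one, map_add, map_smul,
    coeff_add, coeff_sub, coeff_neg, coeff_smul, coeff_laplacian, coeff_dotGradient, hq, hp]
  refine Matrix.vec2_eq ?_ (by ring)
  linear_combination -(1 / 2 - μ)⁻¹ * coupling
    - γ * coeff (convolution σ (fieldAverage S X.1.snd.fst)) m * inv_mul_cancel₀ hμ'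

theorem eq_of_reducedSource_eq {Y Z : StateSpace d n}
    (h : reducedSource γ σ S μ Y = reducedSource γ σ S μ Z) (h_snd : Y.snd = Z.snd) : Y = Z := by
  rw [reducedSource_apply, reducedSource_apply, h_snd] at h
  have hq := sub_left_injective (congrArg WithLp.fst h)
  have hp := congrArg WithLp.snd h
  exact WithLp.ofLp_injective _ (Prod.ext (WithLp.ofLp_injective _ (Prod.ext hq hp)) h_snd)

theorem operatorL_sub_smul_eq_iff (hμ : μ ≠ 1 / 2) (X : domainL d n) (Y : StateSpace d n) :
    operatorL k γ σ S X - μ • (X : StateSpace d n) = Y ↔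
      (∀ m, (reducedSymbol k (couplingSymbol γ σ S) m μ).mulVec (pairCoeff m X.1.fst) =
        pairCoeff m (reducedSource γ σ S μ Y)) ∧
      (1 / 2 - μ) • X.1.snd.fst + (γ : ℂ) • tensorField S (convolution σ X.1.fst.fst) =
        Y.snd.fst ∧
      (1 / 2 - μ) • X.1.snd.snd = Y.snd.snd := by
  simp only [← pairCoeff_reducedSource_operatorL k γ σ S hμ]
  constructor
  · rintro rfl
    rw [operatorL_sub_smul_apply]
    exact ⟨fun _ => rfl, rfl, rfl⟩
  · rintro ⟨h_fst, hφ, hπ⟩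
    refine eq_of_reducedSource_eq γ σ S (pairCoeff_ext h_fst) (WithLp.ofLp_injective _ ?_)
    rw [operatorL_sub_smul_apply]
    exact Prod.ext hφ hπ

end Elimination

/-! ### Eigenspaces -/

section Eigenspace

theorem mem_eigenspace_iff {V : Type*} [NormedAddCommGroup V] [NormedSpace ℂ V] {A : V →ₗ.[ℂ] V}
    {μ : ℂ} {x : V} : x ∈ eigenspace A μ ↔ ∃ h : x ∈ A.domain, A ⟨x, h⟩ - μ • x = 0 :=
  ⟨fun ⟨y, hy, hyx⟩ => hyx ▸ ⟨y.2, hy⟩, fun ⟨h, hx⟩ => ⟨⟨x, h⟩, hx, rfl⟩⟩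

variable {d n : ℕ} {k : Fin d → ℤ} {γ : ℝ} {σ : C(Torus d, ℝ)} {S : L2Space n} {μ : ℂ}

theorem mem_eigenspace_operatorL_iff (hμ : μ ≠ 1 / 2) {X : StateSpace d n} :
    X ∈ eigenspace (operatorL k γ σ S) μ ↔ X ∈ domainL d n ∧
      (∀ m, (reducedSymbol k (couplingSymbol γ σ S) m μ).mulVec (pairCoeff m X.fst) = 0) ∧
      (1 / 2 - μ) • X.snd.fst + (γ : ℂ) • tensorField S (convolution σ X.fst.fst) = 0 ∧
      (1 / 2 - μ) • X.snd.snd = 0 := by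
  rw [mem_eigenspace_iff, ← exists_prop]
  refine exists_congr fun h => ?_
  have key := operatorL_sub_smul_eq_iff k γ σ S hμ ⟨X, h⟩ 0
  simp only [map_zero, WithLp.zero_fst, WithLp.zero_snd] at key
  exact key

/-- The restriction of the Fourier coefficients of `(q, p)` to the singular modes. -/
def eigenspaceToKer (hμ : μ ≠ 1 / 2) : eigenspace (operatorL k γ σ S) μ →ₗ[ℂ]
    (m : singularModes k (couplingSymbol γ σ S) μ) →
      LinearMap.ker (reducedSymbol k (couplingSymbol γ σ S) m μ).mulVecLin :=
  LinearMap.pi fun m =>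
    ((pairCoeff m.1 ∘ₗ WithLp.fstₗ 2 ℂ _ _) ∘ₗ Submodule.subtype _).codRestrict _ fun X =>
      ((mem_eigenspace_operatorL_iff hμ).mp X.2).2.1 m

theorem eigenspaceToKer_injective (hμ : μ ≠ 1 / 2) :
    Function.Injective (eigenspaceToKer hμ (k := k) (γ := γ) (σ := σ) (S := S)) := by
  refine (injective_iff_map_eq_zero _).mpr fun X hX => Subtype.ext ?_
  obtain ⟨-, h_modes, hφ, hπ⟩ := (mem_eigenspace_operatorL_iff hμ).mp X.2
  have h_fst : X.1.fst = 0 := pairCoeff_ext fun m => by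
    rw [map_zero]
    by_cases hm : m ∈ singularModes k (couplingSymbol γ σ S) μ
    · exact congrArg Subtype.val (congrFun hX ⟨m, hm⟩)
    · exact Matrix.eq_zero_of_mulVec_eq_zero hm (h_modes m)
  have hμ' : 1 / 2 - μ ≠ 0 := sub_ne_zero.mpr hμ.symm
  rw [h_fst, WithLp.zero_fst, map_zero, map_zero, smul_zero, add_zero] at hφ
  exact WithLp.ofLp_injective _ (Prod.ext h_fst (WithLp.ofLp_injective _
    (Prod.ext ((smul_eq_zero_iff_right hμ').mp hφ) ((smul_eq_zero_iff_right hμ').mp hπ))))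

theorem exists_mem_sobolevTwo_pairCoeff_eq {s : Set (Fin d → ℤ)} (hs : s.Finite)
    {w : (Fin d → ℤ) → Fin 2 → ℂ} (hw : ∀ m ∉ s, w m = 0) :
    ∃ v : WithLp 2 (L2Torus d × L2Torus d), v.fst ∈ sobolevTwo d ∧ v.snd ∈ sobolevTwo d ∧
      ∀ m, pairCoeff m v = w m := by
  let f (i : Fin 2) : L2Torus d := ∑' m, w m i • characterL2 m
  have coeff_f (i m) : coeff (f i) m = w m i :=
    coeff_tsum_smul_characterL2 (summable_of_ne_finset_zero (s := hs.toFinset) fun m hm => by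
      rw [hw m (mt hs.mem_toFinset.mpr hm), Pi.zero_apply, zero_smul]) m
  have f_mem (i) : f i ∈ sobolevTwo d := mem_sobolevTwo_iff.mpr
    (summable_of_ne_finset_zero (s := hs.toFinset) fun m hm => by
      rw [coeff_f, hw m (mt hs.mem_toFinset.mpr hm), Pi.zero_apply, mul_zero, norm_zero,
        zero_pow two_ne_zero])
  exact ⟨WithLp.toLp 2 (f 0, f 1), f_mem 0, f_mem 1, fun m =>
    funext (Fin.forall_fin_two.mpr ⟨coeff_f 0 m, coeff_f 1 m⟩)⟩

theorem eigenspaceToKer_surjective (hμ : μ ≠ 1 / 2) :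
    Function.Surjective (eigenspaceToKer hμ (k := k) (γ := γ) (σ := σ) (S := S)) := by
  classical
  intro f
  let w (m : Fin d → ℤ) : Fin 2 → ℂ := if h : _ then f ⟨m, h⟩ else 0
  obtain ⟨v, hv_fst, hv_snd, hv⟩ := exists_mem_sobolevTwo_pairCoeff_eq (w := w)
    (finite_singularModes (k := k) (bddAbove_norm_couplingSymbol γ σ S) hμ)
    fun m hm => dif_neg hm
  let X : StateSpace d n := WithLp.toLp 2 (v, WithLp.toLp 2
    (-((1 / 2 - μ)⁻¹ • (γ : ℂ) • tensorField S (convolution σ v.fst)), 0))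
  have hX : X ∈ eigenspace (operatorL k γ σ S) μ := by
    refine (mem_eigenspace_operatorL_iff hμ).mpr ⟨⟨hv_fst, hv_snd⟩, fun m => ?_, ?_, smul_zero _⟩
    · change Matrix.mulVec _ (pairCoeff m v) = 0
      rw [hv]
      by_cases hm : m ∈ singularModes k (couplingSymbol γ σ S) μ
      · rw [show w m = _ from dif_pos hm]
        exact (f ⟨m, hm⟩).2
      · rw [show w m = _ from dif_neg hm, Matrix.mulVec_zero]
    · change (1 / 2 - μ) • -((1 / 2 - μ)⁻¹ • (γ : ℂ) • tensorField S (convolution σ v.fst)) +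
        (γ : ℂ) • tensorField S (convolution σ v.fst) = 0
      rw [smul_neg, smul_inv_smul₀ (sub_ne_zero.mpr hμ.symm), neg_add_cancel]
  exact ⟨⟨X, hX⟩, funext fun m => Subtype.ext ((hv m.1).trans (dif_pos m.2))⟩

/-- For `μ ≠ 1/2`, the identification of the eigenspace of `μ` with the product of the kernels of
the reduced symbol on the singular modes. -/
def eigenspaceEquivKer (hμ : μ ≠ 1 / 2) : eigenspace (operatorL k γ σ S) μ ≃ₗ[ℂ]
    (m : singularModes k (couplingSymbol γ σ S) μ) →
      LinearMap.ker (reducedSymbol k (couplingSymbol γ σ S) m μ).mulVecLin :=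
  .ofBijective (eigenspaceToKer hμ) ⟨eigenspaceToKer_injective hμ, eigenspaceToKer_surjective hμ⟩

theorem finiteDimensional_eigenspace_operatorL (hμ : μ ≠ 1 / 2) :
    FiniteDimensional ℂ (eigenspace (operatorL k γ σ S) μ) := by
  have := (finite_singularModes (k := k) (bddAbove_norm_couplingSymbol γ σ S) hμ).to_subtype
  exact (eigenspaceEquivKer hμ).symm.finiteDimensional

theorem eigenspace_operatorL_ne_bot_iff (hμ : μ ≠ 1 / 2) :
    eigenspace (operatorL k γ σ S) μ ≠ ⊥ ↔
      (singularModes k (couplingSymbol γ σ S) μ).Nonempty := by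
  rw [← Submodule.nontrivial_iff_ne_bot, (eigenspaceEquivKer hμ).toEquiv.nontrivial_congr]
  constructor
  · intro _
    by_contra! h
    have := Set.isEmpty_coe_sort.mpr h
    exact not_subsingleton ((m : singularModes k (couplingSymbol γ σ S) μ) →
      LinearMap.ker (reducedSymbol k (couplingSymbol γ σ S) m μ).mulVecLin) inferInstance
  · rintro ⟨m, hm⟩
    obtain ⟨v, hv, hmv⟩ := Matrix.exists_mulVec_eq_zero_iff.mpr hm
    have := nontrivial_of_ne
      (⟨v, hmv⟩ : LinearMap.ker (reducedSymbol k (couplingSymbol γ σ S) m μ).mulVecLin) 0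
      fun h => hv (congrArg Subtype.val h)
    exact Pi.nontrivial_at (⟨m, hm⟩ : singularModes k (couplingSymbol γ σ S) μ)

theorem finrank_eigenspace_operatorL (hμ : μ ≠ 1 / 2)
    (h : ∀ m ∈ singularModes k (couplingSymbol γ σ S) μ,
      reducedSymbol k (couplingSymbol γ σ S) m μ ≠ 0) :
    Module.finrank ℂ (eigenspace (operatorL k γ σ S) μ) =
      (singularModes k (couplingSymbol γ σ S) μ).ncard := by
  have := (finite_singularModes (k := k) (bddAbove_norm_couplingSymbol γ σ S) hμ).fintype
  rw [(eigenspaceEquivKer hμ).finrank_eq, Module.finrank_pi_fintype,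
    Finset.sum_congr rfl fun (m : singularModes k (couplingSymbol γ σ S) μ) _ =>
      finrank_ker_mulVecLin_eq_one (h m.1 m.2) m.2,
    Finset.sum_const, smul_eq_mul, mul_one, Finset.card_univ, ← Nat.card_eq_fintype_card,
    Nat.card_coe_set_eq]

end Eigenspace

/-! ### The resolvent and the essential spectrum -/

section Spectrum

section Abstract

variable {V : Type*} [NormedAddCommGroup V] [NormedSpace ℂ V] {A : V →ₗ.[ℂ] V} {μ : ℂ}

theorem mem_unboundedSpectrum_of_eigenspace_ne_bot (h : eigenspace A μ ≠ ⊥) :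
    μ ∈ unboundedSpectrum A := by
  rintro ⟨R, -, hR⟩
  refine h ((Submodule.eq_bot_iff _).mpr fun x hx => ?_)
  obtain ⟨hxA, hx⟩ := mem_eigenspace_iff.mp hx
  have hx0 : R (A ⟨x, hxA⟩ - μ • x) = x := hR ⟨x, hxA⟩
  rw [← hx0, hx, map_zero]

theorem mem_resolventSet_of_rightInverse (hA : eigenspace A μ = ⊥) (R : V →L[ℂ] V)
    (hR : ∀ y, ∃ h : R y ∈ A.domain, A ⟨R y, h⟩ - μ • R y = y) : μ ∈ resolventSet A := by
  refine ⟨R, hR, fun x => ?_⟩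
  obtain ⟨h, hy⟩ := hR (A x - μ • (x : V))
  refine sub_eq_zero.mp ((Submodule.mem_bot ℂ).mp ?_)
  rw [← hA]
  refine mem_eigenspace_iff.mpr ⟨sub_mem h x.2, ?_⟩
  rw [← sub_eq_zero.mpr hy, smul_sub, ← sub_sub_sub_comm]
  exact congrArg (· - _) (A.map_sub ⟨_, h⟩ x)

end Abstract

variable {d n : ℕ}

/-- The operator acting on the pairs `(q, p)` as a bounded matrix of Fourier multipliers. -/
def matrixMultiplier (A : (Fin d → ℤ) → Matrix (Fin 2) (Fin 2) ℂ)
    (hA : ∀ i j, BddAbove (Set.range fun m => ‖A m i j‖)) :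
    WithLp 2 (L2Torus d × L2Torus d) →L[ℂ] WithLp 2 (L2Torus d × L2Torus d) :=
  let M (i : Fin 2) := boundedMultiplier _ (hA i 0) ∘L WithLp.fstL 2 ℂ _ _ +
    boundedMultiplier _ (hA i 1) ∘L WithLp.sndL 2 ℂ _ _
  hilbertProd (M 0) (M 1)

theorem pairCoeff_matrixMultiplier {A : (Fin d → ℤ) → Matrix (Fin 2) (Fin 2) ℂ}
    (hA : ∀ i j, BddAbove (Set.range fun m => ‖A m i j‖))
    (v : WithLp 2 (L2Torus d × L2Torus d)) (m : Fin d → ℤ) :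
    pairCoeff m (matrixMultiplier A hA v) = (A m).mulVec (pairCoeff m v) := by
  have coeff_row (i : Fin 2) : coeff (boundedMultiplier _ (hA i 0) v.fst +
      boundedMultiplier _ (hA i 1) v.snd : L2Torus d) m = (A m).mulVec (pairCoeff m v) i := by
    rw [coeff_add, coeff_boundedMultiplier, coeff_boundedMultiplier, Matrix.mulVec, dotProduct,
      Fin.sum_univ_two, pairCoeff_apply, Matrix.cons_val_zero, Matrix.cons_val_one]
    rfl
  exact funext (Fin.forall_fin_two.mpr ⟨coeff_row 0, coeff_row 1⟩)

theorem matrixMultiplier_mem_sobolevTwo {A : (Fin d → ℤ) → Matrix (Fin 2) (Fin 2) ℂ}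
    (hA : ∀ i j, BddAbove (Set.range fun m => ‖A m i j‖))
    (hA' : ∀ i j, BddAbove (Set.range fun m : Fin d → ℤ =>
      ‖(1 + ((m ⬝ᵥ m : ℤ) : ℝ)) * A m i j‖)) (v : WithLp 2 (L2Torus d × L2Torus d)) :
    (matrixMultiplier A hA v).fst ∈ sobolevTwo d ∧ (matrixMultiplier A hA v).snd ∈ sobolevTwo d :=
  have row_mem (i : Fin 2) : boundedMultiplier _ (hA i 0) v.fst +
      boundedMultiplier _ (hA i 1) v.snd ∈ sobolevTwo d :=
    add_mem (boundedMultiplier_mem_sobolevTwo _ (hA' i 0) _)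
      (boundedMultiplier_mem_sobolevTwo _ (hA' i 1) _)
  ⟨row_mem 0, row_mem 1⟩

theorem bddAbove_norm_of_bddAbove_norm_one_add_mul {a : (Fin d → ℤ) → ℂ}
    (ha : BddAbove (Set.range fun m : Fin d → ℤ => ‖(1 + ((m ⬝ᵥ m : ℤ) : ℝ)) * a m‖)) :
    BddAbove (Set.range fun m => ‖a m‖) := by
  refine ha.range_mono _ fun m => ?_
  have hm := dotProduct_self_nonneg_real m
  rw [norm_mul, ← Complex.ofReal_one, ← Complex.ofReal_add, Complex.norm_real,
    Real.norm_of_nonneg (by positivity)]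
  exact le_mul_of_one_le_left (norm_nonneg _) (le_add_of_nonneg_right hm)

variable {k : Fin d → ℤ} {γ : ℝ} {σ : C(Torus d, ℝ)} {S : L2Space n} {μ : ℂ}

theorem mem_resolventSet_operatorL (hμ : μ ≠ 1 / 2)
    (h : singularModes k (couplingSymbol γ σ S) μ = ∅) :
    μ ∈ resolventSet (operatorL k γ σ S) := by
  have hμ' : 1 / 2 - μ ≠ 0 := sub_ne_zero.mpr hμ.symm
  have bdd' := bddAbove_norm_one_add_mul_inv_reducedSymbol (k := k)
    (bddAbove_norm_couplingSymbol γ σ S) hμ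
  have bdd := fun i j => bddAbove_norm_of_bddAbove_norm_one_add_mul (bdd' i j)
  let V := matrixMultiplier _ bdd ∘L reducedSource γ σ S μ
  let Φ : StateSpace d n →L[ℂ] L2Field d n := (1 / 2 - μ)⁻¹ •
    (WithLp.fstL 2 ℂ _ _ ∘L WithLp.sndL 2 ℂ _ _ -
      (γ : ℂ) • (tensorField S ∘L convolutionCLM σ ∘L WithLp.fstL 2 ℂ _ _ ∘L V))
  let Ψ : StateSpace d n →L[ℂ] L2Field d n :=
    (1 / 2 - μ)⁻¹ • (WithLp.sndL 2 ℂ _ _ ∘L WithLp.sndL 2 ℂ _ _)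
  refine mem_resolventSet_of_rightInverse
    (not_not.mp fun hbot => ((eigenspace_operatorL_ne_bot_iff hμ).mp hbot).ne_empty h)
    (hilbertProd V (hilbertProd Φ Ψ)) fun Y => ?_
  have Y_mem : hilbertProd V (hilbertProd Φ Ψ) Y ∈ domainL d n :=
    matrixMultiplier_mem_sobolevTwo bdd bdd' _
  refine ⟨Y_mem, (operatorL_sub_smul_eq_iff k γ σ S hμ ⟨_, Y_mem⟩ Y).mpr ⟨fun m => ?_, ?_, ?_⟩⟩
  · have hm : IsUnit (reducedSymbol k (couplingSymbol γ σ S) m μ).det :=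
      isUnit_iff_ne_zero.mpr (Set.eq_empty_iff_forall_notMem.mp h m)
    change Matrix.mulVec _ (pairCoeff m (matrixMultiplier _ bdd (reducedSource γ σ S μ Y))) = _
    rw [pairCoeff_matrixMultiplier, Matrix.mulVec_mulVec, Matrix.mul_nonsing_inv _ hm,
      Matrix.one_mulVec]
  · change (1 / 2 - μ) • (1 / 2 - μ)⁻¹ •
      (Y.snd.fst - (γ : ℂ) • tensorField S (convolutionCLM σ (V Y).fst)) +
      (γ : ℂ) • tensorField S (convolution σ (V Y).fst) = _
    rw [smul_inv_smul₀ hμ', convolutionCLM_apply, sub_add_cancel]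
  · exact smul_inv_smul₀ hμ' Y.snd.snd

theorem mem_unboundedSpectrum_operatorL_iff (hμ : μ ≠ 1 / 2) :
    μ ∈ unboundedSpectrum (operatorL k γ σ S) ↔
      (singularModes k (couplingSymbol γ σ S) μ).Nonempty :=
  ⟨fun h => Set.nonempty_iff_ne_empty.mpr fun hempty => h (mem_resolventSet_operatorL hμ hempty),
    fun h => mem_unboundedSpectrum_of_eigenspace_ne_bot
      ((eigenspace_operatorL_ne_bot_iff hμ).mpr h)⟩

variable (d n) in
/-- The inclusion of the field `π` in the state space. -/
def inclPi : L2Field d n →ₗ[ℂ] StateSpace d n where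
  toFun π := WithLp.toLp 2 (0, WithLp.toLp 2 (0, π))
  map_add' π ρ := by
    simp only [← WithLp.toLp_add, Prod.mk_add_mk, add_zero]
  map_smul' t π := by
    simp only [RingHom.id_apply, ← WithLp.toLp_smul, Prod.smul_mk, smul_zero]

theorem inclPi_mem_eigenspace (π : L2Field d n) :
    inclPi d n π ∈ eigenspace (operatorL k γ σ S) (1 / 2) := by
  refine mem_eigenspace_iff.mpr ⟨⟨zero_mem _, zero_mem _⟩, ?_⟩
  have hq : compQ d n ⟨inclPi d n π, zero_mem _, zero_mem _⟩ = 0 := rfl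
  have hp : compP d n ⟨inclPi d n π, zero_mem _, zero_mem _⟩ = 0 := rfl
  refine (operatorL_sub_smul_apply k γ σ S ⟨inclPi d n π, zero_mem _, zero_mem _⟩).trans ?_
  rw [hq, hp]
  simp [inclPi]

theorem not_finiteDimensional_eigenspace_half (hn : 0 < n) :
    ¬ FiniteDimensional ℂ (eigenspace (operatorL k γ σ S) (1 / 2)) := by
  intro _
  refine not_finiteDimensional_L2Field (d := d) hn (FiniteDimensional.of_injective
    ((inclPi d n).codRestrict _ (inclPi_mem_eigenspace (k := k) (γ := γ) (σ := σ) (S := S)))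
    fun π ρ h => ?_)
  exact congrArg (fun X : eigenspace (operatorL k γ σ S) (1 / 2) => X.1.snd.snd) h

theorem essentialSpectrum_operatorL (hn : 0 < n) :
    essentialSpectrum (operatorL k γ σ S) = {1 / 2} := by
  refine Set.eq_singleton_iff_unique_mem.mpr ⟨⟨?_, ?_⟩, fun μ hμ_mem => ?_⟩
  · refine mem_unboundedSpectrum_of_eigenspace_ne_bot fun hbot => ?_
    refine not_finiteDimensional_eigenspace_half (k := k) (γ := γ) (σ := σ) (S := S) hn ?_
    rw [hbot]
    infer_instance
  · exact fun h => not_finiteDimensional_eigenspace_half hn h.2.2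
  · by_contra hμ
    refine hμ_mem.2 ⟨?_, ?_, finiteDimensional_eigenspace_operatorL hμ⟩
    · have isolated : ∀ᶠ ν in 𝓝[≠] μ, ν ∉ unboundedSpectrum (operatorL k γ σ S) := by
        filter_upwards [eventually_singularModes_eq_empty (bddAbove_norm_couplingSymbol γ σ S) hμ,
          eventually_nhdsWithin_of_eventually_nhds (eventually_ne_nhds hμ)] with ν hν hν' hν_mem
        exact ((mem_unboundedSpectrum_operatorL_iff hν').mp hν_mem).ne_empty hν
      obtain ⟨ε, hε, hball⟩ := Metric.eventually_nhds_iff.mp (eventually_nhdsWithin_iff.mp isolated)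
      exact ⟨ε, hε, fun ν hν_mem hν => by_contra fun hne =>
        hball (dist_eq_norm ν μ ▸ hν) hne hν_mem⟩
    · exact (eigenspace_operatorL_ne_bot_iff hμ).mpr
        ((mem_unboundedSpectrum_operatorL_iff hμ).mp hμ_mem.1)

end Spectrum

/-! ### The nonpositive eigenvalues -/

section SchurComplement

/-- The Schur complement of the entry `a / 2 - μ` in `modeMatrix a b t μ`, for real parameters: its
zeros are the values of `μ` at which that matrix is singular. On the zero mode `a = b = 0`, the
convention `0 / 0 = 0` makes the last term vanish also at `μ = 0`. -/
def schurComplement (a b t μ : ℝ) : ℝ :=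
  a / 2 - μ - t / (1 / 2 - μ) - b ^ 2 / (a / 2 - μ)

theorem det_modeMatrix_ofReal_eq_zero_iff {a b t μ : ℝ} (h : a / 2 - μ ≠ 0) :
    (modeMatrix a b t μ).det = 0 ↔ schurComplement a b t μ = 0 := by
  have factor : (a / 2 - μ - t / (1 / 2 - μ)) * (a / 2 - μ) - b ^ 2 =
      (a / 2 - μ) * schurComplement a b t μ := by
    rw [schurComplement, mul_sub _ _ (b ^ 2 / _), mul_div_cancel₀ _ h, mul_comm]
  rw [← mul_eq_zero_iff_left h, ← factor, ← Complex.ofReal_eq_zero, det_modeMatrix]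
  push_cast
  rfl

variable {a b t : ℝ}

theorem strictAntiOn_schurComplement (ha : 0 ≤ a) (ht : 0 ≤ t) (hab : a = 0 → b = 0) :
    StrictAntiOn (schurComplement a b t) (Set.Iic 0) := by
  intro μ _ ν (hν : ν ≤ 0) hμν
  have coupling_le : t / (1 / 2 - μ) ≤ t / (1 / 2 - ν) :=
    div_le_div_of_nonneg_left ht (by linarith) (by linarith)
  have transport_le : b ^ 2 / (a / 2 - μ) ≤ b ^ 2 / (a / 2 - ν) := by
    rcases ha.eq_or_lt with rfl | ha
    · rw [hab rfl, sq, zero_mul, zero_div, zero_div]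
    · exact div_le_div_of_nonneg_left (sq_nonneg b) (by linarith) (by linarith)
  unfold schurComplement
  linarith

theorem continuousOn_schurComplement (ha : 0 ≤ a) (hab : a = 0 → b = 0) :
    ContinuousOn (schurComplement a b t) (Set.Iic 0) := by
  have coupling : ContinuousOn (fun μ => t / (1 / 2 - μ)) (Set.Iic 0) :=
    continuousOn_const.div (by fun_prop) fun μ (hμ : μ ≤ 0) => by linarith
  have transport : ContinuousOn (fun μ => b ^ 2 / (a / 2 - μ)) (Set.Iic 0) := by
    rcases ha.eq_or_lt with rfl | ha
    · simp only [hab rfl, sq, zero_mul, zero_div, continuousOn_const]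
    · exact continuousOn_const.div (by fun_prop) fun μ (hμ : μ ≤ 0) => by linarith
  exact (ContinuousOn.sub (by fun_prop) coupling).sub transport

theorem exists_schurComplement_pos (ha : 0 ≤ a) (ht : 0 ≤ t) :
    ∃ μ < 0, 0 < schurComplement a b t μ := by
  refine ⟨-(2 * t + |b| + 1), by linarith [abs_nonneg b], ?_⟩
  have coupling_le : t / (1 / 2 - -(2 * t + |b| + 1)) ≤ 2 * t := by
    rw [div_le_iff₀ (by linarith [abs_nonneg b])]
    nlinarith [abs_nonneg b]
  have transport_le : b ^ 2 / (a / 2 - -(2 * t + |b| + 1)) ≤ |b| := by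
    rw [div_le_iff₀ (by linarith [abs_nonneg b]), ← sq_abs]
    nlinarith [abs_nonneg b]
  unfold schurComplement
  linarith

theorem exists_schurComplement_eq_zero_iff (ha : 0 ≤ a) (ht : 0 ≤ t) (hab : a = 0 → b = 0) :
    (∃ μ < 0, schurComplement a b t μ = 0) ↔ schurComplement a b t 0 < 0 := by
  constructor
  · rintro ⟨μ, hμ, h⟩
    have h0 := strictAntiOn_schurComplement ha ht hab hμ.le Set.self_mem_Iic hμ
    rwa [h] at h0
  · intro h0
    obtain ⟨ν, hν, hpos⟩ := exists_schurComplement_pos (b := b) ha ht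
    obtain ⟨μ, hμ, h⟩ := intermediate_value_Icc' hν.le
      ((continuousOn_schurComplement ha hab).mono Set.Icc_subset_Iic_self) ⟨h0.le, hpos.le⟩
    exact ⟨μ, hμ.2.lt_of_ne fun hμ0 => h0.ne (hμ0 ▸ h), h⟩

theorem le_sq_sub_four_mul_sq {a b : ℤ} (ha : 0 ≤ a) (h : 0 < a ^ 2 - 4 * b ^ 2) :
    a ≤ a ^ 2 - 4 * b ^ 2 := by
  have two_mul_abs_lt : 2 * |b| < a :=
    lt_of_pow_lt_pow_left₀ 2 ha (by rw [mul_pow, sq_abs]; linarith)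
  rw [← sq_abs b]
  nlinarith [abs_nonneg b]

theorem schurComplement_zero (ha : a ≠ 0) :
    schurComplement a b t 0 = (a ^ 2 - 4 * b ^ 2 - 4 * t * a) / (2 * a) := by
  rw [schurComplement, eq_div_iff (mul_ne_zero two_ne_zero ha), sub_zero, sub_zero]
  field_simp
  ring

theorem schurComplement_zero_pos_iff {a b : ℤ} (ha : 0 < a) (ht0 : 0 ≤ t) (ht1 : t < 1 / 4) :
    0 < schurComplement a b t 0 ↔ 0 < a ^ 2 - 4 * b ^ 2 := by
  have ha' : (0 : ℝ) < a := Int.cast_pos.mpr ha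
  rw [schurComplement_zero ha'.ne', div_pos_iff_of_pos_right (by positivity)]
  refine ⟨fun h => ?_, fun h => ?_⟩
  · have : (0 : ℝ) < a ^ 2 - 4 * b ^ 2 := by nlinarith
    exact_mod_cast this
  · have : (a : ℝ) ≤ a ^ 2 - 4 * b ^ 2 := by exact_mod_cast le_sq_sub_four_mul_sq ha.le h
    nlinarith

theorem schurComplement_zero_eq_zero_iff {a b : ℤ} (ha : 0 < a) (ht0 : 0 ≤ t) (ht1 : t < 1 / 4) :
    schurComplement a b t 0 = 0 ↔ a ^ 2 - 4 * b ^ 2 = 0 ∧ t = 0 := by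
  have ha' : (0 : ℝ) < a := Int.cast_pos.mpr ha
  have formula := schurComplement_zero (b := b) (t := t) ha'.ne'
  constructor
  · intro h
    have nonpos : ((a ^ 2 - 4 * b ^ 2 : ℤ) : ℝ) ≤ 0 := Int.cast_nonpos.mpr
      (not_lt.mp ((schurComplement_zero_pos_iff ha ht0 ht1).not.mp h.not_gt))
    rw [h, eq_comm, div_eq_zero_iff, or_iff_left (by positivity)] at formula
    push_cast at nonpos
    have ht : t = 0 := le_antisymm (nonpos_of_mul_nonpos_left (by linarith) ha') ht0
    rw [ht, mul_zero, zero_mul, sub_zero] at formula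
    exact ⟨by exact_mod_cast formula, ht⟩
  · rintro ⟨h, rfl⟩
    rw [formula, mul_zero, zero_mul, sub_zero, div_eq_zero_iff]
    exact Or.inl (by exact_mod_cast h)

theorem schurComplement_zero_neg_iff {a b : ℤ} (ha : 0 < a) (ht0 : 0 ≤ t) (ht1 : t < 1 / 4) :
    schurComplement a b t 0 < 0 ↔
      (a ^ 2 - 4 * b ^ 2 < 0 ∧ t = 0) ∨ (a ^ 2 - 4 * b ^ 2 ≤ 0 ∧ t ≠ 0) := by
  rw [lt_iff_le_and_ne, ← not_lt, schurComplement_zero_pos_iff ha ht0 ht1, not_lt, Ne,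
    schurComplement_zero_eq_zero_iff ha ht0 ht1]
  grind

end SchurComplement

section NegativeModes

variable {d : ℕ} {k : Fin d → ℤ} {t : (Fin d → ℤ) → ℝ}

theorem dotProduct_self_pos {ι : Type*} [Fintype ι] {m : ι → ℤ} (hm : m ≠ 0) : 0 < m ⬝ᵥ m :=
  (Finset.sum_nonneg fun j _ => mul_self_nonneg (m j)).lt_of_ne'
    (dotProduct_self_eq_zero.not.mpr hm)

theorem dotProduct_eq_zero_of_dotProduct_self_eq_zero {ι : Type*} [Fintype ι] {k m : ι → ℤ}
    (hm : ((m ⬝ᵥ m : ℤ) : ℝ) = 0) : ((k ⬝ᵥ m : ℤ) : ℝ) = 0 := by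
  rw [dotProduct_self_eq_zero.mp (Int.cast_eq_zero.mp hm), dotProduct_zero, Int.cast_zero]

theorem finite_setOf_sq_sub_nonpos (k : Fin d → ℤ) :
    {m : Fin d → ℤ | (m ⬝ᵥ m) ^ 2 - 4 * (k ⬝ᵥ m) ^ 2 ≤ 0}.Finite := by
  have large := (tendsto_dotProduct_self_cofinite (ι := Fin d)).eventually
    (eventually_gt_atTop (4 * ((k ⬝ᵥ k : ℤ) : ℝ)))
  refine (eventually_cofinite.mp large).subset fun m hm => ?_
  rw [Set.mem_ofPred_eq, not_lt]
  have hm' : ((m ⬝ᵥ m : ℤ) : ℝ) ^ 2 - 4 * ((k ⬝ᵥ m : ℤ) : ℝ) ^ 2 ≤ 0 := by exact_mod_cast hm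
  by_contra! h
  nlinarith [dotProduct_sq_le k m, dotProduct_self_nonneg_real m, dotProduct_self_nonneg_real k]

theorem mem_singularModes_ofReal_iff {m : Fin d → ℤ} {μ : ℝ} (h : ((m ⬝ᵥ m : ℤ) : ℝ) / 2 ≠ μ) :
    m ∈ singularModes k (fun m => (t m : ℂ)) μ ↔
      schurComplement (m ⬝ᵥ m : ℤ) (k ⬝ᵥ m : ℤ) (t m) μ = 0 := by
  have h := det_modeMatrix_ofReal_eq_zero_iff (b := (k ⬝ᵥ m : ℤ)) (t := t m) (sub_ne_zero.mpr h)
  exact_mod_cast h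

/-- The Fourier modes that carry a negative eigenvalue, for the coupling strengths `t`. -/
def negativeModes (k : Fin d → ℤ) (t : (Fin d → ℤ) → ℝ) : Set (Fin d → ℤ) :=
  {m | schurComplement (m ⬝ᵥ m : ℤ) (k ⬝ᵥ m : ℤ) (t m) 0 < 0}

theorem mem_singularModes_ofReal_iff_of_neg {m : Fin d → ℤ} {μ : ℝ} (hμ : μ < 0) :
    m ∈ singularModes k (fun m => (t m : ℂ)) μ ↔
      schurComplement (m ⬝ᵥ m : ℤ) (k ⬝ᵥ m : ℤ) (t m) μ = 0 :=
  mem_singularModes_ofReal_iff (by linarith [dotProduct_self_nonneg_real m])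

theorem biUnion_singularModes (ht : ∀ m, 0 ≤ t m) :
    ⋃ μ ∈ Set.Iio (0 : ℝ), singularModes k (fun m => (t m : ℂ)) μ = negativeModes k t := by
  ext m
  rw [Set.mem_iUnion₂]
  exact (exists_congr fun μ => exists_prop.trans
    (and_congr_right mem_singularModes_ofReal_iff_of_neg)).trans
    (exists_schurComplement_eq_zero_iff (dotProduct_self_nonneg_real m) (ht m)
      dotProduct_eq_zero_of_dotProduct_self_eq_zero)

theorem pairwiseDisjoint_singularModes (ht : ∀ m, 0 ≤ t m) :
    (Set.Iio (0 : ℝ)).PairwiseDisjoint fun μ => singularModes k (fun m => (t m : ℂ)) μ := by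
  refine fun μ (hμ : μ < 0) ν (hν : ν < 0) hne => Set.disjoint_left.mpr fun m hmμ hmν => hne ?_
  rw [mem_singularModes_ofReal_iff_of_neg ‹_›] at hmμ hmν
  exact (strictAntiOn_schurComplement (dotProduct_self_nonneg_real m) (ht m)
    dotProduct_eq_zero_of_dotProduct_self_eq_zero).injOn hμ.le hν.le (hmμ.trans hmν.symm)

theorem negativeModes_eq_insert (ht0 : ∀ m, 0 ≤ t m) (ht1 : ∀ m, t m < 1 / 4) (h0 : 0 < t 0) :
    negativeModes k t = insert 0
      ({m | m ≠ 0 ∧ (m ⬝ᵥ m) ^ 2 - 4 * (k ⬝ᵥ m) ^ 2 < 0 ∧ t m = 0} ∪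
        {m | m ≠ 0 ∧ (m ⬝ᵥ m) ^ 2 - 4 * (k ⬝ᵥ m) ^ 2 ≤ 0 ∧ t m ≠ 0}) := by
  ext m
  rcases eq_or_ne m 0 with rfl | hm
  · refine iff_of_true ?_ (Set.mem_insert 0 _)
    simpa [negativeModes, schurComplement] using h0
  · simp only [Set.mem_insert_iff, hm, false_or, Set.mem_union, Set.mem_ofPred_eq, ne_eq,
      not_false_eq_true, true_and]
    exact schurComplement_zero_neg_iff (dotProduct_self_pos hm) (ht0 m) (ht1 m)

theorem singularModes_zero_eq_insert (ht0 : ∀ m, 0 ≤ t m) (ht1 : ∀ m, t m < 1 / 4) :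
    singularModes k (fun m => (t m : ℂ)) 0 = insert 0
      {m | m ≠ 0 ∧ (m ⬝ᵥ m) ^ 2 - 4 * (k ⬝ᵥ m) ^ 2 = 0 ∧ t m = 0} := by
  ext m
  rcases eq_or_ne m 0 with rfl | hm
  · refine iff_of_true ?_ (Set.mem_insert 0 _)
    simp [singularModes, reducedSymbol, det_modeMatrix]
  · simp only [Set.mem_insert_iff, hm, false_or, Set.mem_ofPred_eq, ne_eq, not_false_eq_true,
      true_and]
    have hpos : (0 : ℝ) < (m ⬝ᵥ m : ℤ) := Int.cast_pos.mpr (dotProduct_self_pos hm)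
    rw [← Complex.ofReal_zero, mem_singularModes_ofReal_iff (by positivity)]
    exact schurComplement_zero_eq_zero_iff (dotProduct_self_pos hm) (ht0 m) (ht1 m)

theorem finite_negativeModes (ht0 : ∀ m, 0 ≤ t m) (ht1 : ∀ m, t m < 1 / 4) (h0 : 0 < t 0) :
    (negativeModes k t).Finite := by
  rw [negativeModes_eq_insert ht0 ht1 h0]
  exact (((finite_setOf_sq_sub_nonpos k).subset fun m hm => hm.2.1.le).union
    ((finite_setOf_sq_sub_nonpos k).subset fun m hm => hm.2.1)).insert 0

theorem ncard_negativeModes (ht0 : ∀ m, 0 ≤ t m) (ht1 : ∀ m, t m < 1 / 4) (h0 : 0 < t 0) :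
    (negativeModes k t).ncard =
      1 + {m | m ≠ 0 ∧ (m ⬝ᵥ m) ^ 2 - 4 * (k ⬝ᵥ m) ^ 2 < 0 ∧ t m = 0}.ncard +
        {m | m ≠ 0 ∧ (m ⬝ᵥ m) ^ 2 - 4 * (k ⬝ᵥ m) ^ 2 ≤ 0 ∧ t m ≠ 0}.ncard := by
  have fin := finite_negativeModes (k := k) ht0 ht1 h0
  rw [negativeModes_eq_insert ht0 ht1 h0, Set.finite_insert, Set.finite_union] at fin
  have zero_notMem :
      0 ∉ {m | m ≠ 0 ∧ (m ⬝ᵥ m) ^ 2 - 4 * (k ⬝ᵥ m) ^ 2 < 0 ∧ t m = 0} ∪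
        {m | m ≠ 0 ∧ (m ⬝ᵥ m) ^ 2 - 4 * (k ⬝ᵥ m) ^ 2 ≤ 0 ∧ t m ≠ 0} :=
    Or.rec (fun h => h.1 rfl) fun h => h.1 rfl
  rw [negativeModes_eq_insert ht0 ht1 h0,
    Set.ncard_insert_of_notMem zero_notMem (fin.1.union fin.2), Set.ncard_union_eq
    (Set.disjoint_left.mpr fun m hA hB => hB.2.2 hA.2.2) fin.1 fin.2, add_comm, add_assoc]

theorem ncard_singularModes_zero (ht0 : ∀ m, 0 ≤ t m) (ht1 : ∀ m, t m < 1 / 4) :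
    (singularModes k (fun m => (t m : ℂ)) 0).ncard =
      1 + {m | m ≠ 0 ∧ (m ⬝ᵥ m) ^ 2 - 4 * (k ⬝ᵥ m) ^ 2 = 0 ∧ t m = 0}.ncard := by
  rw [singularModes_zero_eq_insert ht0 ht1, Set.ncard_insert_of_notMem (fun h => h.1 rfl)
    ((finite_setOf_sq_sub_nonpos k).subset fun m hm => hm.2.1.le), add_comm]

theorem negativeModes_zero (ht0 : ∀ m, 0 ≤ t m) (ht1 : ∀ m, t m < 1 / 4) (h0 : 0 < t 0) :
    negativeModes 0 t = {0} := by
  have pos : ∀ m : Fin d → ℤ, m ≠ 0 → 0 < (m ⬝ᵥ m) ^ 2 - 4 * (0 ⬝ᵥ m) ^ 2 := fun m hm => by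
    rw [zero_dotProduct, zero_pow two_ne_zero, mul_zero, sub_zero]
    exact pow_pos (dotProduct_self_pos hm) 2
  rw [negativeModes_eq_insert ht0 ht1 h0]
  refine Set.eq_singleton_iff_unique_mem.mpr ⟨Set.mem_insert 0 _, ?_⟩
  rintro m (hm | hm | hm)
  exacts [hm, ((pos m hm.1).not_gt hm.2.1).elim, ((pos m hm.1).not_ge hm.2.1).elim]

end NegativeModes

section Index

variable {d n : ℕ} {k : Fin d → ℤ} {γ : ℝ} {σ : C(Torus d, ℝ)} {S : L2Space n}
  {t : (Fin d → ℤ) → ℝ}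

theorem ofReal_ne_half {μ : ℝ} (hμ : μ < 0) : (μ : ℂ) ≠ 1 / 2 := by
  refine fun h => hμ.not_gt ?_
  rw [← Complex.ofReal_re μ, h]
  norm_num

theorem negativeEigenvalues_operatorL : negativeEigenvalues (operatorL k γ σ S) =
    {μ ∈ Set.Iio (0 : ℝ) | (singularModes k (couplingSymbol γ σ S) (μ : ℂ)).Nonempty} :=
  Set.ext fun _ => and_congr_right fun hμ => eigenspace_operatorL_ne_bot_iff (ofReal_ne_half hμ)

theorem finrank_eigenspace_operatorL_of_neg {μ : ℝ} (hμ : μ < 0) :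
    Module.finrank ℂ (eigenspace (operatorL k γ σ S) (μ : ℂ)) =
      (singularModes k (couplingSymbol γ σ S) μ).ncard := by
  refine finrank_eigenspace_operatorL (ofReal_ne_half hμ) fun m _ h => ?_
  have entry : ((m ⬝ᵥ m : ℤ) / 2 - μ : ℂ) = 0 := congrFun₂ h 1 1
  have entry_ne_zero : ((m ⬝ᵥ m : ℤ) : ℝ) / 2 - μ ≠ 0 := by
    linarith [dotProduct_self_nonneg_real m]
  exact entry_ne_zero (by exact_mod_cast entry)

theorem finite_negativeEigenvalues_operatorL
    (hT : couplingSymbol γ σ S = fun m => (t m : ℂ)) (ht : ∀ m, 0 ≤ t m)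
    (hfin : (negativeModes k t).Finite) :
    (negativeEigenvalues (operatorL k γ σ S)).Finite := by
  rw [negativeEigenvalues_operatorL, hT]
  rw [← biUnion_singularModes ht, (pairwiseDisjoint_singularModes ht).finite_biUnion_iff] at hfin
  exact hfin.2

theorem negativeIndex_operatorL
    (hT : couplingSymbol γ σ S = fun m => (t m : ℂ)) (ht : ∀ m, 0 ≤ t m)
    (hfin : (negativeModes k t).Finite) :
    negativeIndex (operatorL k γ σ S) = (negativeModes k t).ncard := by
  have neg : negativeEigenvalues (operatorL k γ σ S) ⊆ Set.Iio 0 := fun μ hμ => hμ.1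
  have union : ⋃ μ ∈ negativeEigenvalues (operatorL k γ σ S),
      singularModes k (fun m => (t m : ℂ)) μ = negativeModes k t := by
    rw [← biUnion_singularModes ht, negativeEigenvalues_operatorL, hT]
    ext m
    simp only [Set.mem_iUnion₂, exists_prop, Set.mem_sep_iff]
    exact exists_congr fun μ => ⟨fun h => ⟨h.1.1, h.2⟩, fun h => ⟨⟨h.1, m, h.2⟩, h.2⟩⟩
  have finite_fibre : ∀ μ ∈ negativeEigenvalues (operatorL k γ σ S),
      (singularModes k (fun m => (t m : ℂ)) μ).Finite := fun μ hμ =>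
    hfin.subset (union ▸ Set.subset_biUnion_of_mem
      (u := fun μ : ℝ => singularModes k (fun m => (t m : ℂ)) μ) hμ)
  rw [← union, (finite_negativeEigenvalues_operatorL hT ht hfin).ncard_biUnion finite_fibre
    ((pairwiseDisjoint_singularModes ht).subset neg), ← hT]
  exact finsum_mem_congr rfl fun μ hμ => finrank_eigenspace_operatorL_of_neg (neg hμ)

theorem finrank_eigenspace_operatorL_zero
    (hT : couplingSymbol γ σ S = fun m => (t m : ℂ)) (h0 : 0 < t 0) :
    Module.finrank ℂ (eigenspace (operatorL k γ σ S) 0) =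
      (singularModes k (couplingSymbol γ σ S) 0).ncard := by
  refine finrank_eigenspace_operatorL (by norm_num) fun m _ h => ?_
  rcases eq_or_ne m 0 with rfl | hm
  · have entry : ((0 ⬝ᵥ 0 : ℤ) / 2 - 0 - couplingSymbol γ σ S 0 / (1 / 2 - 0) : ℂ) = 0 :=
      congrFun₂ h 0 0
    simp [hT, h0.ne'] at entry
  · have entry : ((m ⬝ᵥ m : ℤ) / 2 - 0 : ℂ) = 0 := congrFun₂ h 1 1
    have hm' := (dotProduct_self_pos hm).ne'
    rw [sub_zero, div_eq_zero_iff, or_iff_left two_ne_zero] at entry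
    exact hm' (by exact_mod_cast entry)

theorem vectorXZero_mem_eigenspace :
    vectorXZero d n ∈ eigenspace (operatorL k γ σ S) 0 := by
  refine (mem_eigenspace_operatorL_iff (by norm_num)).mpr
    ⟨⟨zero_mem _, characterL2_mem_sobolevTwo 0⟩, fun m => ?_, ?_, smul_zero _⟩
  · change Matrix.mulVec _ ![coeff (0 : L2Torus d) m, coeff (characterL2 0) m] = 0
    rw [coeff_zero, coeff_characterL2]
    split_ifs with h
    · subst h
      exact funext (Fin.forall_fin_two.mpr ⟨by simp [reducedSymbol, modeMatrix],
        by simp [reducedSymbol, modeMatrix]⟩)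
    · simp
  · change (1 / 2 - 0 : ℂ) • (0 : L2Field d n) + (γ : ℂ) • tensorField S (convolution σ 0) = 0
    rw [map_zero, map_zero, smul_zero, smul_zero, add_zero]

end Index

section CouplingStrength

variable {d n : ℕ} {γ κ : ℝ} {σ : C(Torus d, ℝ)} {S : L2Space n}

/-- The value of `couplingSymbol` for an even profile `σ` and a field `S` with `∫ S² = κ`. -/
def couplingStrength (γ κ : ℝ) (σ : C(Torus d, ℝ)) (m : Fin d → ℤ) : ℝ :=
  (γ * ‖(2 * Real.pi : ℂ) ^ d * coeff (fun x => (σ x : ℂ)) m‖) ^ 2 * κ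

theorem couplingSymbol_eq_couplingStrength (hσ : ∀ x, σ (-x) = σ x)
    (hS : ∫ z, S z * S z = (κ : ℂ)) :
    couplingSymbol γ σ S = fun m => (couplingStrength γ κ σ m : ℂ) := by
  funext m
  have real : conj ((2 * Real.pi : ℂ) ^ d * coeff (fun x => (σ x : ℂ)) m) =
      (2 * Real.pi : ℂ) ^ d * coeff (fun x => (σ x : ℂ)) m := by
    rw [map_mul, conj_coeff_ofReal_of_even hσ]
    norm_cast
    rw [Complex.conj_ofReal]
  rw [couplingSymbol, couplingStrength, hS]
  push_cast
  rw [mul_pow, mul_pow (γ : ℂ), ← Complex.mul_conj', real, sq (_ * _)]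

theorem couplingStrength_nonneg (hκ : 0 ≤ κ) (m : Fin d → ℤ) : 0 ≤ couplingStrength γ κ σ m :=
  mul_nonneg (sq_nonneg _) hκ

theorem couplingStrength_lt (hκ : 0 ≤ κ) (h : 4 * γ ^ 2 * κ * (∫ x, |σ x|) ^ 2 < 1)
    (m : Fin d → ℤ) : couplingStrength γ κ σ m < 1 / 4 := by
  have coeff_le : ‖(2 * Real.pi : ℂ) ^ d * coeff (fun x => (σ x : ℂ)) m‖ ≤ ∫ x, |σ x| := by
    simpa only [Complex.norm_real, Real.norm_eq_abs] using
      norm_two_pi_pow_mul_coeff_le (fun x => (σ x : ℂ)) m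
  calc couplingStrength γ κ σ m
      = γ ^ 2 * ‖(2 * Real.pi : ℂ) ^ d * coeff (fun x => (σ x : ℂ)) m‖ ^ 2 * κ := by
        rw [couplingStrength, mul_pow]
    _ ≤ γ ^ 2 * (∫ x, |σ x|) ^ 2 * κ := by gcongr
    _ < 1 / 4 := by linarith

theorem couplingStrength_eq_zero_iff (hγ : γ ≠ 0) (hκ : κ ≠ 0) (m : Fin d → ℤ) :
    couplingStrength γ κ σ m = 0 ↔ coeff (fun x => (σ x : ℂ)) m = 0 := by
  rw [couplingStrength, mul_eq_zero_iff_right hκ, sq_eq_zero_iff, mul_eq_zero_iff_left hγ,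
    norm_eq_zero, mul_eq_zero_iff_left (two_pi_pow_ne_zero d)]

theorem couplingStrength_zero_pos (hγ : γ ≠ 0) (hκ : 0 < κ) (hσ : ∫ x, σ x ≠ 0) :
    0 < couplingStrength γ κ σ 0 := by
  refine (couplingStrength_nonneg hκ.le 0).lt_of_ne' fun h => hσ ?_
  rw [couplingStrength_eq_zero_iff hγ hκ.ne'] at h
  have mean := two_pi_pow_mul_coeff_ofReal_zero σ
  rw [h, mul_zero] at mean
  exact_mod_cast mean.symm

end CouplingStrength

end SchrodingerWave

end

open SchrodingerWave in
theorem mainTheorem6_general {d n : ℕ} (hn : 0 < n) (k : Fin d → ℤ) {γ κ : ℝ} (hγ : γ ≠ 0)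
    (hκ : 0 < κ) (σ₁ : C(Torus d, ℝ)) (S : L2Space n) (hS : ∫ z, S z * S z = (κ : ℂ))
    (hσ₁_even : ∀ x, σ₁ (-x) = σ₁ x) (hσ₁_mean : ∫ x, σ₁ x ≠ 0)
    (hsmall : 4 * γ ^ 2 * κ * (∫ x, |σ₁ x|) ^ 2 < 1) :
    let L := operatorL k γ σ₁ S
    let c : (Fin d → ℤ) → ℂ := coeff fun x => (σ₁ x : ℂ)
    let A : Set (Fin d → ℤ) := {m | m ≠ 0 ∧ (m ⬝ᵥ m) ^ 2 - 4 * (k ⬝ᵥ m) ^ 2 < 0 ∧ c m = 0}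
    let B : Set (Fin d → ℤ) := {m | m ≠ 0 ∧ (m ⬝ᵥ m) ^ 2 - 4 * (k ⬝ᵥ m) ^ 2 ≤ 0 ∧ c m ≠ 0}
    let K : Set (Fin d → ℤ) := {m | m ≠ 0 ∧ (m ⬝ᵥ m) ^ 2 - 4 * (k ⬝ᵥ m) ^ 2 = 0 ∧ c m = 0}
    essentialSpectrum L = {1 / 2} ∧
    ((negativeEigenvalues L).Finite ∧
      (∀ μ ∈ negativeEigenvalues L, FiniteDimensional ℂ (eigenspace L (μ : ℂ))) ∧
      A.Finite ∧ B.Finite ∧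
      negativeIndex L = 1 + A.ncard + B.ncard ∧
      (k = 0 → negativeIndex L = 1)) ∧
    (Submodule.span ℝ {vectorXZero d n} ≤ (eigenspace L 0).restrictScalars ℝ ∧
      FiniteDimensional ℂ (eigenspace L 0) ∧
      K.Finite ∧
      Module.finrank ℂ (eigenspace L 0) = 1 + K.ncard) := by
  intro L c A B K
  have hT := couplingSymbol_eq_couplingStrength (γ := γ) hσ₁_even hS
  have ht0 := couplingStrength_nonneg (γ := γ) (σ := σ₁) hκ.le
  have ht1 := couplingStrength_lt hκ.le hsmall
  have h0 := couplingStrength_zero_pos hγ hκ hσ₁_mean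
  have hc := couplingStrength_eq_zero_iff (σ := σ₁) hγ hκ.ne'
  have modes_finite := finite_negativeModes (k := k) ht0 ht1 h0
  have index : negativeIndex L = 1 + A.ncard + B.ncard := by
    rw [negativeIndex_operatorL hT ht0 modes_finite, ncard_negativeModes ht0 ht1 h0]
    simp only [hc, ne_eq, A, B, c]
  have nullity : Module.finrank ℂ (eigenspace L 0) = 1 + K.ncard := by
    rw [finrank_eigenspace_operatorL_zero hT h0, hT, ncard_singularModes_zero ht0 ht1]
    simp only [hc, K, c]
  refine ⟨essentialSpectrum_operatorL hn, ⟨finite_negativeEigenvalues_operatorL hT ht0 modes_finite,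
    fun μ hμ => finiteDimensional_eigenspace_operatorL (ofReal_ne_half hμ.1),
    (finite_setOf_sq_sub_nonpos k).subset fun m hm => hm.2.1.le,
    (finite_setOf_sq_sub_nonpos k).subset fun m hm => hm.2.1, index, ?_⟩,
    (Submodule.span_singleton_le_iff_mem _ _).mpr vectorXZero_mem_eigenspace,
    finiteDimensional_eigenspace_operatorL (by norm_num),
    (finite_setOf_sq_sub_nonpos k).subset fun m hm => hm.2.1.le, nullity⟩
  rintro rfl
  rw [negativeIndex_operatorL hT ht0 modes_finite, negativeModes_zero ht0 ht1 h0,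
    Set.ncard_singleton]

theorem mainTheorem6 {d n : ℕ} (hn : 3 ≤ n) (k : Fin d → ℤ) (γ : ℝ) (hγ : 0 < γ)
    (σ₁ : C(SchrodingerWave.Torus d, ℝ))
    (σ₂ : EuclideanSpace ℝ (Fin n) → ℝ)
    (hσ₁_nonneg : ∀ x, 0 ≤ σ₁ x)
    (hσ₁_smooth : ContDiff ℝ ∞ fun x : Fin d → ℝ =>
      σ₁ fun j => (x j : AddCircle (2 * Real.pi)))
    (hσ₁_even : ∀ x, σ₁ (-x) = σ₁ x)
    (hσ₁_mean : ∫ x, σ₁ x ≠ 0)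
    (hσ₂_nonneg : ∀ z, 0 ≤ σ₂ z)
    (hσ₂_smooth : ContDiff ℝ ∞ σ₂)
    (hσ₂_radial : ∀ z w, ‖z‖ = ‖w‖ → σ₂ z = σ₂ w)
    (hσ₂_supp : HasCompactSupport σ₂)
    (hσ₂_riesz : MemLp (SchrodingerWave.rieszSymbol σ₂) 2 volume)
    (hσ₂_fourier : ∀ ξ, 𝓕 (fun z => (σ₂ z : ℂ)) ξ ≠ 0)
    (hsmall : 4 * γ ^ 2 * SchrodingerWave.kappa σ₂ * (∫ x, |σ₁ x|) ^ 2 < 1) :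
    let S := SchrodingerWave.invSqrtLaplacian σ₂ hσ₂_riesz
    let L := SchrodingerWave.operatorL k γ σ₁ S
    let c : (Fin d → ℤ) → ℂ := SchrodingerWave.coeff fun x => (σ₁ x : ℂ)
    let A : Set (Fin d → ℤ) := {m | m ≠ 0 ∧ (m ⬝ᵥ m) ^ 2 - 4 * (k ⬝ᵥ m) ^ 2 < 0 ∧ c m = 0}
    let B : Set (Fin d → ℤ) := {m | m ≠ 0 ∧ (m ⬝ᵥ m) ^ 2 - 4 * (k ⬝ᵥ m) ^ 2 ≤ 0 ∧ c m ≠ 0}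
    let K : Set (Fin d → ℤ) := {m | m ≠ 0 ∧ (m ⬝ᵥ m) ^ 2 - 4 * (k ⬝ᵥ m) ^ 2 = 0 ∧ c m = 0}
    SchrodingerWave.essentialSpectrum L = {1 / 2} ∧
    ((SchrodingerWave.negativeEigenvalues L).Finite ∧
      (∀ μ ∈ SchrodingerWave.negativeEigenvalues L,
        FiniteDimensional ℂ (SchrodingerWave.eigenspace L (μ : ℂ))) ∧
      A.Finite ∧ B.Finite ∧
      SchrodingerWave.negativeIndex L = 1 + A.ncard + B.ncard ∧
      (k = 0 → SchrodingerWave.negativeIndex L = 1)) ∧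
    (Submodule.span ℝ {SchrodingerWave.vectorXZero d n} ≤
        (SchrodingerWave.eigenspace L 0).restrictScalars ℝ ∧
      FiniteDimensional ℂ (SchrodingerWave.eigenspace L 0) ∧
      K.Finite ∧
      Module.finrank ℂ (SchrodingerWave.eigenspace L 0) = 1 + K.ncard) := by
  exact mainTheorem6_general (by omega) k hγ.ne' (SchrodingerWave.kappa_pos σ₂ (by omega) hσ₂_riesz
    hσ₂_fourier) σ₁ _ (SchrodingerWave.integral_invSqrtLaplacian_mul_self σ₂ hσ₂_riesz) hσ₁_even
    hσ₁_mean hsmall
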